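/- Let $R$ be a (not necessarily commutative) ring that is left and right noetherian. For $n\ge 1$ let $\mathcal{E}_n(R_R)$ be the class of those finitely generated left $R$-modules that are isomorphic to $\mathrm{Ext}^n_{R^{op}}(N,R)$ for some finitely generated right $R$-module $N$, where the left $R$-module structure on $\mathrm{Ext}^n_{R^{op}}(N,R)$ comes from left multiplication on $R$. A class of finitely generated left $R$-modules is called submodule-closed if every non-zero submodule of a module in the class is again in the class. Let $$0\to {}_RR\to I_0\to I_1\to\cdots\to I_i\to\cdots$$ be a minimal injective resolution of the left module ${}_RR$. The ring $R$ is called Auslander–Gorenstein if it is left and right noetherian, the injective dimensions of ${}_RR$ and $R_R$ are finite, and the flat dimension of the left module $I_i$ is at most $i$ for every $i\ge 0$. Let $n\le 2$ be a non-negative integer, and assume that the injective dimensions of ${}_RR$ and $R_R$ are equal and at most $n$. (1) If $n=1$, then $\mathcal{E}_1(R_R)$ is submodule-closed if and only if $I_0$ is flat, and $I_0$ is flat if and only if $R$ is Auslander–Gorenstein. (2) If $n=2$, then $\mathcal{E}_2(R_R)$ is submodule-closed if and only if the flat dimension of the left module $I_0\oplus I_1$ is at most $1$. -/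

import Mathlib

open scoped TensorProduct

universe u v w

namespace NoncommRing

/-! Left `R`-modules are `R`-modules; right `R`-modules are `Rᵐᵒᵖ`-modules. -/

section Flat

/-- The subgroup of `N ⊗[ℤ] M` generated by the elements `n r ⊗ m - n ⊗ r m`, for a right
`R`-module `N` and a left `R`-module `M`. -/
def balancedRel (R : Type u) [Ring R] (N : Type w) [AddCommGroup N] [Module Rᵐᵒᵖ N]
    (M : Type v) [AddCommGroup M] [Module R M] : AddSubgroup (N ⊗[ℤ] M) :=
  AddSubgroup.closure {t | ∃ (n : N) (r : R) (m : M),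
    t = (MulOpposite.op r • n) ⊗ₜ[ℤ] m - n ⊗ₜ[ℤ] (r • m)}

/-- The tensor product `N ⊗_R M` (an abelian group) of a right `R`-module `N` and a left
`R`-module `M` over a ring `R` that need not be commutative. -/
abbrev BalancedTensor (R : Type u) [Ring R] (N : Type w) [AddCommGroup N] [Module Rᵐᵒᵖ N]
    (M : Type v) [AddCommGroup M] [Module R M] : Type (max v w) :=
  (N ⊗[ℤ] M) ⧸ balancedRel R N M

/-- The homomorphism `f ⊗ id : N ⊗[ℤ] M → N' ⊗[ℤ] M`. -/
noncomputable def intMap {R : Type u} [Ring R] {N N' : Type w} [AddCommGroup N] [Module Rᵐᵒᵖ N]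
    [AddCommGroup N'] [Module Rᵐᵒᵖ N'] (f : N →ₗ[Rᵐᵒᵖ] N')
    (M : Type v) [AddCommGroup M] : N ⊗[ℤ] M →+ N' ⊗[ℤ] M :=
  (LinearMap.rTensor M f.toAddMonoidHom.toIntLinearMap).toAddMonoidHom

theorem balancedRel_le_comap {R : Type u} [Ring R] {N N' : Type w}
    [AddCommGroup N] [Module Rᵐᵒᵖ N] [AddCommGroup N'] [Module Rᵐᵒᵖ N'] (f : N →ₗ[Rᵐᵒᵖ] N')
    (M : Type v) [AddCommGroup M] [Module R M] :
    balancedRel R N M ≤ (balancedRel R N' M).comap (intMap f M) := by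
  refine (AddSubgroup.closure_le _).2 ?_
  rintro _ ⟨n, r, m, rfl⟩
  exact AddSubgroup.subset_closure ⟨f n, r, m, by simp [intMap]⟩

/-- The homomorphism `f ⊗ id : N ⊗_R M → N' ⊗_R M` induced by a homomorphism `f : N → N'` of
right `R`-modules. -/
noncomputable def BalancedTensor.map {R : Type u} [Ring R] {N N' : Type w}
    [AddCommGroup N] [Module Rᵐᵒᵖ N] [AddCommGroup N'] [Module Rᵐᵒᵖ N'] (f : N →ₗ[Rᵐᵒᵖ] N')
    (M : Type v) [AddCommGroup M] [Module R M] :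
    BalancedTensor R N M →+ BalancedTensor R N' M :=
  QuotientAddGroup.map _ _ (intMap f M) (balancedRel_le_comap f M)

/-- A left `R`-module `M` is flat if `- ⊗_R M` preserves injectivity of homomorphisms of right
`R`-modules. -/
def IsFlat (R : Type u) [Ring R] (M : Type v) [AddCommGroup M] [Module R M] : Prop :=
  ∀ (N N' : Type u) [AddCommGroup N] [Module Rᵐᵒᵖ N] [AddCommGroup N'] [Module Rᵐᵒᵖ N']
    (f : N →ₗ[Rᵐᵒᵖ] N'), Function.Injective f → Function.Injective (BalancedTensor.map f M)

/-- The left `R`-module `M` has flat dimension at most `n`: there is an exact sequence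
`0 → F_n → ⋯ → F_0 → M → 0` with all `F_i` flat, built up one syzygy at a time. -/
def HasFlatDimensionLE (R : Type u) [Ring R] :
    ℕ → ∀ (M : Type u) [AddCommGroup M] [Module R M], Prop
  | 0, M, _, _ => IsFlat R M
  | n + 1, M, _, _ => ∃ (F : Type u) (_ : AddCommGroup F) (_ : Module R F) (p : F →ₗ[R] M),
      IsFlat R F ∧ Function.Surjective p ∧ HasFlatDimensionLE R n (LinearMap.ker p)

end Flat

section Injective

/-- A submodule is essential if it meets every nonzero submodule nontrivially. -/
def IsEssential {R : Type u} [Ring R] {E : Type v} [AddCommGroup E] [Module R E]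
    (L : Submodule R E) : Prop :=
  ∀ K : Submodule R E, K ≠ ⊥ → L ⊓ K ≠ ⊥

/-- A minimal injective resolution `0 → M → I 0 → I 1 → ⋯` of a left `R`-module `M`: an exact
sequence with all `I i` injective, in which the image of `M` is essential in `I 0` and the image
of `I i` is essential in `I (i + 1)`. -/
structure MinimalInjectiveResolution (R : Type u) [Ring R] (M : Type u) [AddCommGroup M]
    [Module R M] where
  I : ℕ → ModuleCat.{u} R
  ε : M →ₗ[R] I 0
  d : ∀ i, I i →ₗ[R] I (i + 1)
  injective : ∀ i, Module.Injective R (I i)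
  ε_injective : Function.Injective ε
  exact_zero : Function.Exact ε (d 0)
  exact_succ : ∀ i, Function.Exact (d i) (d (i + 1))
  essential_zero : IsEssential (LinearMap.range ε)
  essential_succ : ∀ i, IsEssential (LinearMap.range (d i))

/-- The injective dimension of `R` as a left module over itself. -/
noncomputable def leftSelfInjDim (R : Type u) [Ring R] : WithBot ℕ∞ :=
  CategoryTheory.injectiveDimension (ModuleCat.of R R)

/-- The injective dimension of `R` as a right module over itself. -/
noncomputable def rightSelfInjDim (R : Type u) [Ring R] : WithBot ℕ∞ :=
  CategoryTheory.injectiveDimension (ModuleCat.of Rᵐᵒᵖ R)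

/-- A two-sided noetherian ring with finite left and right self-injective dimensions. -/
def IsIwanagaGorenstein (R : Type u) [Ring R] : Prop :=
  IsNoetherianRing R ∧ IsNoetherianRing Rᵐᵒᵖ ∧ leftSelfInjDim R < ⊤ ∧ rightSelfInjDim R < ⊤

/-- The Auslander condition: in a minimal injective resolution `0 → R → I 0 → I 1 → ⋯` of the
left module `R`, the flat dimension of `I i` is at most `i` for all `i`. -/
def AuslanderCondition (R : Type u) [Ring R] : Prop :=
  ∃ J : MinimalInjectiveResolution R R, ∀ i, HasFlatDimensionLE R i (J.I i)

/-- Auslander–Gorenstein rings. -/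
def IsAuslanderGorenstein (R : Type u) [Ring R] : Prop :=
  IsIwanagaGorenstein R ∧ AuslanderCondition R

end Injective

section Ext

open CategoryTheory Abelian

/-- Left multiplication by `r`, an endomorphism of the right module `R`. -/
def leftMul (R : Type u) [Ring R] (r : R) : ModuleCat.of Rᵐᵒᵖ R ⟶ ModuleCat.of Rᵐᵒᵖ R :=
  ModuleCat.ofHom
    { toFun := fun x => r * x
      map_add' := fun x y => mul_add r x y
      map_smul' := fun s x => (mul_assoc r x s.unop).symm }

/-- The group `Ext^n(N, R)` of right `R`-modules, for a right module `N`. -/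
def RightExt (R : Type u) [Ring R] (N : ModuleCat.{u} Rᵐᵒᵖ) (n : ℕ) : Type u :=
  Ext.{u} N (ModuleCat.of Rᵐᵒᵖ R) n

noncomputable instance (R : Type u) [Ring R] (N : ModuleCat.{u} Rᵐᵒᵖ) (n : ℕ) :
    AddCommGroup (RightExt R N n) :=
  inferInstanceAs (AddCommGroup (Ext.{u} N (ModuleCat.of Rᵐᵒᵖ R) n))

/-- The left `R`-module structure of `Ext^n(N, R)`: the scalar `r` acts through the endomorphism
`x ↦ r x` of the second argument. -/
noncomputable instance (R : Type u) [Ring R] (N : ModuleCat.{u} Rᵐᵒᵖ) (n : ℕ) :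
    Module R (RightExt R N n) where
  smul r x := Ext.comp (X := N) x (Ext.mk₀ (leftMul R r)) (add_zero n)
  one_smul x := by
    have h : leftMul R 1 = 𝟙 _ := by ext; simp [leftMul]
    change Ext.comp (X := N) x (Ext.mk₀ (leftMul R 1)) (add_zero n) = x
    rw [h]
    exact Ext.comp_mk₀_id x
  mul_smul r s x := by
    have h : leftMul R (r * s) = leftMul R s ≫ leftMul R r := by
      ext; simp [leftMul]
    change Ext.comp (X := N) x (Ext.mk₀ (leftMul R (r * s))) (add_zero n) =
      Ext.comp (X := N) (Ext.comp (X := N) x (Ext.mk₀ (leftMul R s)) (add_zero n))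
        (Ext.mk₀ (leftMul R r)) (add_zero n)
    rw [h, ← Ext.mk₀_comp_mk₀]
    exact (Ext.comp_assoc_of_third_deg_zero (X := N) x (Ext.mk₀ (leftMul R s))
      (Ext.mk₀ (leftMul R r)) (add_zero n)).symm
  smul_zero r := Ext.zero_comp (X := N) _ _ _ (add_zero n)
  smul_add r x y := Ext.add_comp (X := N) _ _ _ (add_zero n)
  add_smul r s x := by
    have h : leftMul R (r + s) = leftMul R r + leftMul R s := by
      ext; simp [leftMul]
    change Ext.comp (X := N) x (Ext.mk₀ (leftMul R (r + s))) (add_zero n) =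
      Ext.comp (X := N) x (Ext.mk₀ (leftMul R r)) (add_zero n) +
      Ext.comp (X := N) x (Ext.mk₀ (leftMul R s)) (add_zero n)
    rw [h, Ext.mk₀_add]
    exact Ext.comp_add _ _ _ _
  zero_smul x := by
    have h : leftMul R 0 = 0 := by ext; simp [leftMul]
    change Ext.comp (X := N) x (Ext.mk₀ (leftMul R 0)) (add_zero n) = 0
    rw [h, Ext.mk₀_zero]
    exact Ext.comp_zero _ _ _ _ _

/-- The class `𝓔_n(R_R)` of the finitely generated left `R`-modules that are isomorphic to
`Ext^n(N, R)` for some finitely generated right `R`-module `N`. -/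
def extClass (R : Type u) [Ring R] (n : ℕ) : ObjectProperty (ModuleCat.{u} R) := fun M =>
  Module.Finite R M ∧ ∃ N : ModuleCat.{u} Rᵐᵒᵖ, Module.Finite Rᵐᵒᵖ N ∧
    Nonempty (M ≃ₗ[R] RightExt R N n)

/-- A class of modules is submodule-closed if it contains every nonzero submodule of each of its
members. -/
def IsSubmoduleClosed {R : Type u} [Ring R] (X : ObjectProperty (ModuleCat.{u} R)) : Prop :=
  ∀ M : ModuleCat.{u} R, X M → ∀ L : Submodule R M, L ≠ ⊥ → X (ModuleCat.of R L)

end Ext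

end NoncommRing

/-! Both sides of each equivalence are turned into statements about homomorphisms from `Ext^n(N,
R)`, `N` a finitely generated right module, into `I_0` (for `n = 1`) or `I_0 × I_1` (for `n = 2`).

Duality `Hom(-, R)` between left and right modules, with self-injective dimension at most `n`,
describes the class intrinsically: a finitely generated `M` lies in it iff `Hom(M, R) = 0` when `n =
1` (`extClass_one_iff`), and iff `Hom(M, R) = 0 = Ext^1(M, R)` when `n = 2` (`extClass_two_iff`). By
essentiality in the minimal resolution, `Hom(X, I_0) = 0`, respectively `Hom(X, I_0 × I_1) = 0`,
says that every submodule of `X` satisfies this vanishing. Hence the class is submodule-closed iff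
all these homomorphisms from `Ext^n(N, R)` vanish.

For an injective left module `I` with character module `I^+`, the duality between `Tor_n(N, I)` and
`Ext^n(N, I^+)`, together with `Tor_n(N, I) ≅ Hom(Ext^n(N, R), I)`, shows that the same vanishing
means flat dimension at most `n - 1` (`isFlat_iff_hom_rightExt_one`,
`hasFlatDimensionLE_one_iff_hom_rightExt_two`). Tor itself is bypassed by
`exists_extension_character_iff`.

If `n = 1`, then `I_1 = I_0/R` and the later terms vanish, so flatness of `I_0` already gives the
Auslander condition. -/

namespace NoncommRing

open CategoryTheory Abelian

/-! ### Short exact sequences of modules and vanishing of Ext -/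

section ExtVanishing

variable {A : Type u} [Ring A]

/-- The vanishing of `Ext^i(M, U)`. -/
abbrev ExtVanishes (A : Type u) [Ring A] (M U : Type u) [AddCommGroup M] [Module A M]
    [AddCommGroup U] [Module A U] (i : ℕ) : Prop :=
  Subsingleton (Ext.{u} (ModuleCat.of A M) (ModuleCat.of A U) i)

variable {L P Y U : Type u} [AddCommGroup L] [Module A L] [AddCommGroup P] [Module A P]
  [AddCommGroup Y] [Module A Y] [AddCommGroup U] [Module A U]

/-- The maps `ι : L → P` and `π : P → Y` form a short exact sequence. -/
structure IsShortExact (ι : L →ₗ[A] P) (π : P →ₗ[A] Y) : Prop where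
  inj : Function.Injective ι
  exact : Function.Exact ι π
  surj : Function.Surjective π

theorem IsShortExact.of_surjective {π : P →ₗ[A] Y} (h : Function.Surjective π) :
    IsShortExact (LinearMap.ker π).subtype π :=
  ⟨Subtype.val_injective, LinearMap.exact_subtype_ker_map π, h⟩

theorem IsShortExact.of_injective {ι : L →ₗ[A] P} (h : Function.Injective ι) :
    IsShortExact ι (LinearMap.range ι).mkQ :=
  ⟨h, LinearMap.exact_map_mkQ_range ι, Submodule.mkQ_surjective _⟩

theorem IsShortExact.of_submodule (N : Submodule A P) : IsShortExact N.subtype N.mkQ :=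
  ⟨Subtype.val_injective, LinearMap.exact_subtype_mkQ N, N.mkQ_surjective⟩

theorem IsShortExact.exists_factor {ι : L →ₗ[A] P} {π : P →ₗ[A] Y} (h : IsShortExact ι π)
    (f : P →ₗ[A] U) (hf : f ∘ₗ ι = 0) : ∃ g : Y →ₗ[A] U, g ∘ₗ π = f := by
  have hk : LinearMap.ker π ≤ LinearMap.ker f := fun p hp => by
    obtain ⟨l, rfl⟩ := (h.exact p).mp hp
    exact LinearMap.congr_fun hf l
  let e := π.quotKerEquivOfSurjective h.surj
  refine ⟨(LinearMap.ker π).liftQ f hk ∘ₗ e.symm.toLinearMap, ?_⟩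
  ext p
  have : e.symm (π p) = (LinearMap.ker π).mkQ p := by
    rw [LinearEquiv.symm_apply_eq]; rfl
  simp [this]

/-- The last term of a right exact sequence is a cokernel. -/
noncomputable def cokernelEquivOfExact {ι : L →ₗ[A] P} {π : P →ₗ[A] Y}
    (h : Function.Exact ι π) (hπ : Function.Surjective π) :
    (P ⧸ LinearMap.range ι) ≃ₗ[A] Y :=
  (Submodule.quotEquivOfEq _ _ h.linearMap_ker_eq.symm).trans (π.quotKerEquivOfSurjective hπ)

/-- The short complex of modules attached to a short exact sequence. -/
abbrev IsShortExact.complex {ι : L →ₗ[A] P} {π : P →ₗ[A] Y} (h : IsShortExact ι π) :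
    ShortComplex (ModuleCat.{u} A) :=
  ShortComplex.mk (ModuleCat.ofHom ι) (ModuleCat.ofHom π)
    (by rw [← ModuleCat.ofHom_comp, h.exact.linearMap_comp_eq_zero]; rfl)

theorem IsShortExact.shortExact {ι : L →ₗ[A] P} {π : P →ₗ[A] Y} (h : IsShortExact ι π) :
    h.complex.ShortExact where
  exact := (ShortComplex.ShortExact.moduleCat_exact_iff_function_exact _).mpr h.exact
  mono_f := (ModuleCat.mono_iff_injective _).mpr h.inj
  epi_g := (ModuleCat.epi_iff_surjective _).mpr h.surj

theorem extVanishes_of_projective (P U : Type u) [AddCommGroup P] [Module A P] [AddCommGroup U]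
    [Module A U] [Module.Projective A P] (i : ℕ) : ExtVanishes A P U (i + 1) :=
  have : Projective (ModuleCat.of A P) := (IsProjective.iff_projective P).mp ‹_›
  Ext.subsingleton_of_projective _ _ _

theorem extVanishes_of_injective (P U : Type u) [AddCommGroup P] [Module A P] [AddCommGroup U]
    [Module A U] [Module.Injective A U] (i : ℕ) : ExtVanishes A P U (i + 1) :=
  have : Injective (ModuleCat.of A U) := (Module.injective_iff_injective_object A U).mp ‹_›
  Ext.subsingleton_of_injective _ _ _

variable {ι : L →ₗ[A] P} {π : P →ₗ[A] Y}

theorem IsShortExact.extVanishes_right (h : IsShortExact ι π) {i : ℕ}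
    (hL : ExtVanishes A L U i) (hP : ExtVanishes A P U (i + 1)) : ExtVanishes A Y U (i + 1) := by
  refine subsingleton_of_forall_eq 0 fun x => ?_
  obtain ⟨y, hy⟩ := Ext.contravariant_sequence_exact₃ h.shortExact (ModuleCat.of A U) x
    (hP.elim _ _) (add_comm 1 i)
  rw [← hy, show y = 0 from hL.elim _ _, Ext.comp_zero]

theorem IsShortExact.extVanishes_left (h : IsShortExact ι π) {i : ℕ}
    (hP : ExtVanishes A P U i) (hY : ExtVanishes A Y U (i + 1)) : ExtVanishes A L U i := by
  refine subsingleton_of_forall_eq 0 fun x => ?_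
  obtain ⟨y, hy⟩ := Ext.contravariant_sequence_exact₁ h.shortExact (ModuleCat.of A U) x
    (add_comm 1 i) (hY.elim _ _)
  rw [← hy, show y = 0 from hP.elim _ _, Ext.comp_zero]

/-- The composite is the class of the pushout of the extension along `f`, which splits exactly when
`f` extends to `P`. -/
theorem IsShortExact.extClass_comp_eq_zero_iff (h : IsShortExact ι π) (f : L →ₗ[A] U) :
    h.shortExact.extClass.comp (Ext.mk₀ (ModuleCat.ofHom f)) (add_zero 1) = 0 ↔
      ∃ g : P →ₗ[A] U, g ∘ₗ ι = f := by
  constructor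
  · intro hf
    obtain ⟨y, hy⟩ := Ext.contravariant_sequence_exact₁ h.shortExact (ModuleCat.of A U) _
      (add_zero 1) hf
    obtain ⟨g, rfl⟩ := (Ext.mk₀_bijective _ _).surjective y
    rw [Ext.mk₀_comp_mk₀] at hy
    exact ⟨g.hom, congrArg ModuleCat.Hom.hom ((Ext.mk₀_bijective _ _).injective hy)⟩
  · rintro ⟨g, rfl⟩
    rw [ModuleCat.ofHom_comp, ← Ext.mk₀_comp_mk₀, ← Ext.comp_assoc_of_second_deg_zero,
      h.shortExact.extClass_comp, Ext.zero_comp]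

theorem IsShortExact.exists_extension (h : IsShortExact ι π) (hY : ExtVanishes A Y U 1)
    (f : L →ₗ[A] U) : ∃ g : P →ₗ[A] U, g ∘ₗ ι = f :=
  (h.extClass_comp_eq_zero_iff f).mp (hY.elim _ _)

theorem IsShortExact.extVanishes_one (h : IsShortExact ι π)
    (hL : ∀ f : L →ₗ[A] U, ∃ g : P →ₗ[A] U, g ∘ₗ ι = f) (hP : ExtVanishes A P U 1) :
    ExtVanishes A Y U 1 := by
  refine subsingleton_of_forall_eq 0 fun x => ?_
  obtain ⟨y, hy⟩ := Ext.contravariant_sequence_exact₃ h.shortExact (ModuleCat.of A U) x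
    (hP.elim _ _) (add_zero 1)
  obtain ⟨f, rfl⟩ := (Ext.mk₀_bijective _ _).surjective y
  rw [← hy]
  exact (h.extClass_comp_eq_zero_iff f.hom).mpr (hL f.hom)

theorem IsShortExact.exists_lift (h : IsShortExact ι π) (hU : ExtVanishes A U L 1)
    (f : U →ₗ[A] Y) : ∃ g : U →ₗ[A] P, π ∘ₗ g = f := by
  obtain ⟨y, hy⟩ := Ext.covariant_sequence_exact₃ (ModuleCat.of A U) h.shortExact
    (Ext.mk₀ (ModuleCat.ofHom f)) (zero_add 1) (hU.elim _ _)
  obtain ⟨g, rfl⟩ := (Ext.mk₀_bijective _ _).surjective y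
  rw [Ext.mk₀_comp_mk₀] at hy
  exact ⟨g.hom, congrArg ModuleCat.Hom.hom ((Ext.mk₀_bijective _ _).injective hy)⟩

theorem IsShortExact.extVanishes_one_of_exists_lift (h : IsShortExact ι π)
    (hP : ExtVanishes A U P 1) (hY : ∀ f : U →ₗ[A] Y, ∃ g : U →ₗ[A] P, π ∘ₗ g = f) :
    ExtVanishes A U L 1 := by
  refine subsingleton_of_forall_eq 0 fun x => ?_
  obtain ⟨y, hy⟩ := Ext.covariant_sequence_exact₁ (ModuleCat.of A U) h.shortExact x
    (hP.elim _ _) (zero_add 1)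
  obtain ⟨f, rfl⟩ := (Ext.mk₀_bijective _ _).surjective y
  obtain ⟨g, hg⟩ := hY f.hom
  have : f = ModuleCat.ofHom g ≫ h.complex.g := by ext1; exact hg.symm
  rw [← hy, this, ← Ext.mk₀_comp_mk₀, Ext.comp_assoc_of_second_deg_zero,
    h.shortExact.comp_extClass, Ext.comp_zero]

end ExtVanishing

/-! ### `Ext^1` and `Ext^2` into `R` as left modules, via connecting maps -/

section RightExt

variable {R : Type u} [Ring R] {L P Y : Type u} [AddCommGroup L] [Module Rᵐᵒᵖ L]
  [AddCommGroup P] [Module Rᵐᵒᵖ P] [AddCommGroup Y] [Module Rᵐᵒᵖ Y]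
  {ι : L →ₗ[Rᵐᵒᵖ] P} {π : P →ₗ[Rᵐᵒᵖ] Y}

/-- The connecting homomorphism `Hom(L, R) → Ext^1(Y, R)`. -/
noncomputable def IsShortExact.homToRightExt (h : IsShortExact ι π) :
    (L →ₗ[Rᵐᵒᵖ] R) →ₗ[R] RightExt R (ModuleCat.of Rᵐᵒᵖ Y) 1 where
  toFun f := h.shortExact.extClass.comp (Ext.mk₀ (ModuleCat.ofHom f)) (add_zero 1)
  map_add' f g := by
    rw [ModuleCat.ofHom_add, Ext.mk₀_add]
    exact Ext.comp_add _ _ _ _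
  map_smul' r f := by
    have : ModuleCat.ofHom (r • f) = ModuleCat.ofHom f ≫ leftMul R r := by ext; rfl
    rw [this, ← Ext.mk₀_comp_mk₀]
    exact (Ext.comp_assoc_of_third_deg_zero _ _ _ _).symm

theorem IsShortExact.homToRightExt_surjective (h : IsShortExact ι π)
    (hP : ExtVanishes Rᵐᵒᵖ P R 1) : Function.Surjective h.homToRightExt := fun x => by
  obtain ⟨y, hy⟩ := Ext.contravariant_sequence_exact₃ h.shortExact (ModuleCat.of Rᵐᵒᵖ R) x
    (hP.elim _ _) (add_zero 1)
  obtain ⟨f, rfl⟩ := (Ext.mk₀_bijective _ _).surjective y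
  exact ⟨f.hom, hy⟩

theorem IsShortExact.ker_homToRightExt (h : IsShortExact ι π) :
    LinearMap.ker h.homToRightExt = LinearMap.range (LinearMap.lcomp R R ι) := by
  ext f
  exact h.extClass_comp_eq_zero_iff f

/-- `Ext^1(Y, R)` as the cokernel of `Hom(P, R) → Hom(L, R)`. -/
noncomputable def IsShortExact.rightExtOneEquiv (h : IsShortExact ι π)
    (hP : ExtVanishes Rᵐᵒᵖ P R 1) :
    ((L →ₗ[Rᵐᵒᵖ] R) ⧸ LinearMap.range (LinearMap.lcomp R R ι)) ≃ₗ[R]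
      RightExt R (ModuleCat.of Rᵐᵒᵖ Y) 1 :=
  (Submodule.quotEquivOfEq _ _ h.ker_homToRightExt.symm).trans
    (h.homToRightExt.quotKerEquivOfSurjective (h.homToRightExt_surjective hP))

/-- The dimension shift `Ext^1(L, R) ≃ Ext^2(Y, R)`. -/
noncomputable def IsShortExact.rightExtTwoEquiv (h : IsShortExact ι π)
    (hP : ExtVanishes Rᵐᵒᵖ P R 1) (hP' : ExtVanishes Rᵐᵒᵖ P R 2) :
    RightExt R (ModuleCat.of Rᵐᵒᵖ L) 1 ≃ₗ[R] RightExt R (ModuleCat.of Rᵐᵒᵖ Y) 2 :=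
  let δ : RightExt R (ModuleCat.of Rᵐᵒᵖ L) 1 →ₗ[R] RightExt R (ModuleCat.of Rᵐᵒᵖ Y) 2 :=
    { toFun := fun x => h.shortExact.extClass.comp x rfl
      map_add' := fun x y => Ext.comp_add _ _ _ _
      map_smul' := fun r x => (Ext.comp_assoc_of_third_deg_zero _ _ _ _).symm }
  LinearEquiv.ofBijective δ
    ⟨(injective_iff_map_eq_zero δ).mpr fun x hx => by
      obtain ⟨y, hy⟩ := Ext.contravariant_sequence_exact₁ h.shortExact (ModuleCat.of Rᵐᵒᵖ R) x
        rfl hx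
      rw [show y = 0 from hP.elim _ _, Ext.comp_zero] at hy
      exact hy.symm,
    fun x => Ext.contravariant_sequence_exact₃ h.shortExact (ModuleCat.of Rᵐᵒᵖ R) x
      (hP'.elim _ _) rfl⟩

end RightExt

/-! ### Duality with respect to a bimodule, set up so that it applies from either side -/

section Duality

variable {A B U : Type u} [Ring A] [Ring B] [AddCommGroup U] [Module A U] [Module B U]

/-- The bimodule `U` is free of rank one on both sides, with common basis element `x`. -/
structure IsTwoSidedGenerator (A B : Type u) {U : Type u} [Ring A] [Ring B] [AddCommGroup U]
    [Module A U] [Module B U] (x : U) : Prop where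
  left : Function.Bijective fun a : A => a • x
  right : Function.Bijective fun b : B => b • x

theorem IsTwoSidedGenerator.swap {x : U} (hx : IsTwoSidedGenerator A B x) :
    IsTwoSidedGenerator B A x :=
  ⟨hx.right, hx.left⟩

variable [SMulCommClass A B U]

theorem IsTwoSidedGenerator.free_dual_pi {x : U} (hx : IsTwoSidedGenerator A B x) (k : ℕ) :
    Module.Free B ((Fin k → A) →ₗ[A] U) ∧ Module.Finite B ((Fin k → A) →ₗ[A] U) := by
  let e : B ≃ₗ[B] U := LinearEquiv.ofBijective (LinearMap.toSpanSingleton B U x) hx.right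
  let e' : (Fin k → B) ≃ₗ[B] ((Fin k → A) →ₗ[A] U) :=
    (LinearEquiv.piCongrRight fun _ => e.trans (LinearMap.ringLmapEquivSelf A B U).symm).trans
      (LinearMap.lsum A (fun _ : Fin k => A) B)
  exact ⟨Module.Free.of_equiv e', Module.Finite.equiv e'⟩

theorem IsShortExact.dual {L P Y : Type u} [AddCommGroup L] [Module A L] [AddCommGroup P]
    [Module A P] [AddCommGroup Y] [Module A Y] {ι : L →ₗ[A] P} {π : P →ₗ[A] Y}
    (h : IsShortExact ι π) (hL : ∀ f : L →ₗ[A] U, ∃ g : P →ₗ[A] U, g ∘ₗ ι = f) :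
    IsShortExact (LinearMap.lcomp B U π) (LinearMap.lcomp B U ι) where
  inj f g hfg := by
    ext y
    obtain ⟨p, rfl⟩ := h.surj y
    exact LinearMap.congr_fun hfg p
  exact f := by
    constructor
    · intro hf
      exact h.exists_factor f hf
    · rintro ⟨g, rfl⟩
      ext l
      simp [h.exact.apply_apply_eq_zero]
  surj f := hL f

theorem IsShortExact.injective_lcomp {L P Y : Type u} [AddCommGroup L] [Module A L]
    [AddCommGroup P] [Module A P] [AddCommGroup Y] [Module A Y] {ι : L →ₗ[A] P} {π : P →ₗ[A] Y}
    (h : IsShortExact ι π) (hY : ∀ f : Y →ₗ[A] U, f = 0) :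
    Function.Injective (LinearMap.lcomp B U ι) := by
  rw [injective_iff_map_eq_zero]
  intro φ hφ
  obtain ⟨g, rfl⟩ := h.exists_factor φ hφ
  rw [hY g, LinearMap.zero_comp]

/-- The two vanishing conditions on `Y` make restriction `Q^* → K^*` an isomorphism, so `Q^*` may
replace `K^*` as the kernel of `P^* → L^*`. -/
theorem IsShortExact.dual_comp {L P K Q Y : Type u} [AddCommGroup L] [Module A L]
    [AddCommGroup P] [Module A P] [AddCommGroup K] [Module A K] [AddCommGroup Q] [Module A Q]
    [AddCommGroup Y] [Module A Y] {ι : L →ₗ[A] P} {π : P →ₗ[A] K} {κ : K →ₗ[A] Q}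
    {ρ : Q →ₗ[A] Y} (h : IsShortExact ι π) (h' : IsShortExact κ ρ)
    (hY : ∀ f : Y →ₗ[A] U, f = 0) (hY₁ : ExtVanishes A Y U 1) :
    IsShortExact (LinearMap.lcomp B U (κ ∘ₗ π)) (LinearMap.lcomp B U ι).rangeRestrict := by
  refine ⟨fun f g hfg => h'.injective_lcomp (B := B) hY ?_, fun ψ => ⟨fun hψ => ?_, ?_⟩,
    LinearMap.surjective_rangeRestrict _⟩
  · ext y
    obtain ⟨p, rfl⟩ := h.surj y
    exact LinearMap.congr_fun hfg p
  · obtain ⟨g, rfl⟩ := h.exists_factor ψ (congrArg Subtype.val hψ)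
    obtain ⟨g, rfl⟩ := h'.exists_extension hY₁ g
    exact ⟨g, rfl⟩
  · rintro ⟨g, rfl⟩
    ext l
    simp [h.exact.apply_apply_eq_zero]

theorem finite_dual [IsNoetherianRing B] {x : U} (hx : IsTwoSidedGenerator A B x) (M : Type u)
    [AddCommGroup M] [Module A M] [Module.Finite A M] : Module.Finite B (M →ₗ[A] U) := by
  obtain ⟨k, π, hπ⟩ := Module.Finite.exists_fin' A M
  have := (hx.free_dual_pi k).2
  refine Module.Finite.of_injective (LinearMap.lcomp B U π) fun f g hfg => ?_
  ext m
  obtain ⟨p, rfl⟩ := hπ m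
  exact LinearMap.congr_fun hfg p

/-- All higher extensions of `M` by `U` vanish. -/
def HigherExtVanish (A M U : Type u) [Ring A] [AddCommGroup M] [Module A M] [AddCommGroup U]
    [Module A U] : Prop :=
  ∀ i, ExtVanishes A M U (i + 1)

theorem IsShortExact.higherExtVanish {L P Y : Type u} [AddCommGroup L] [Module A L]
    [AddCommGroup P] [Module A P] [AddCommGroup Y] [Module A Y] {ι : L →ₗ[A] P} {π : P →ₗ[A] Y}
    (h : IsShortExact ι π) (hP : HigherExtVanish A P U) (hY : HigherExtVanish A Y U) :
    HigherExtVanish A L U := fun i => h.extVanishes_left (hP i) (hY (i + 1))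

/-- The dual of `0 → K → A^k → L → 0` stays exact with free middle term, so vanishing of
`Ext^(i+2)(K^*, U)` forces that of `Ext^(i+1)(L^*, U)`. The kernel `K` inherits the hypothesis, and
the degree climbs past the injective dimension of `U`. -/
theorem higherExtVanish_dual [IsNoetherianRing A] {x : U} (hx : IsTwoSidedGenerator A B x) {m : ℕ}
    (hm : HasInjectiveDimensionLT (ModuleCat.of B U) m) (L : Type u) [AddCommGroup L] [Module A L]
    [Module.Finite A L] (hL : HigherExtVanish A L U) : HigherExtVanish B (L →ₗ[A] U) U := by
  -- `j` bounds how far the degree `i + 1` lies below `m`; at `j = 0` the injective dimension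
  -- applies directly.
  suffices ∀ j i, m ≤ i + 1 + j → ∀ (L : Type u) [AddCommGroup L] [Module A L]
      [Module.Finite A L], HigherExtVanish A L U → ExtVanishes B (L →ₗ[A] U) U (i + 1) from
    fun i => this m i (by omega) L hL
  intro j
  induction j with
  | zero =>
    intro i hi L _ _ _ _
    exact hm.subsingleton _ _ _ hi _
  | succ j ih =>
    intro i hi L _ _ _ hL
    obtain ⟨k, π, hπ⟩ := Module.Finite.exists_fin' A L
    have h := IsShortExact.of_surjective hπ
    have h' := h.dual (B := B) (h.exists_extension (hL 0))
    have := (hx.free_dual_pi k).1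
    exact h'.extVanishes_left (extVanishes_of_projective _ _ _)
      (ih (i + 1) (by omega) _ (h.higherExtVanish (fun _ => extVanishes_of_projective _ _ _) hL))

variable [SMulCommClass B A U]

variable (A B U) in
/-- The evaluation map from a module to its bidual with respect to the bimodule `U`. -/
def bidualMap (M : Type u) [AddCommGroup M] [Module A M] :
    M →ₗ[A] ((M →ₗ[A] U) →ₗ[B] U) where
  toFun m :=
    { toFun := fun φ => φ m
      map_add' := fun _ _ => rfl
      map_smul' := fun _ _ => rfl }
  map_add' x y := by ext φ; exact φ.map_add x y
  map_smul' a x := by ext φ; exact φ.map_smul a x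

@[simp]
theorem bidualMap_apply {M : Type u} [AddCommGroup M] [Module A M] (m : M) (φ : M →ₗ[A] U) :
    bidualMap A B U M m φ = φ m := rfl

theorem IsTwoSidedGenerator.bijective_bidualMap_pi {x : U} (hx : IsTwoSidedGenerator A B x)
    (k : ℕ) : Function.Bijective (bidualMap A B U (Fin k → A)) := by
  -- The functionals `ε i` generate the dual over `B`, so an element of the bidual is determined by
  -- its values on them.
  let ε : Fin k → ((Fin k → A) →ₗ[A] U) := fun i =>
    (LinearMap.toSpanSingleton A U x) ∘ₗ LinearMap.proj i
  have hε : ∀ i v, ε i v = v i • x := fun i v => rfl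
  constructor
  · rw [injective_iff_map_eq_zero]
    intro v hv
    funext i
    apply hx.left.injective
    have := LinearMap.congr_fun hv (ε i)
    simpa [hε] using this
  · intro Φ
    choose a ha using fun i => hx.left.surjective (Φ (ε i))
    refine ⟨a, LinearMap.ext fun φ => ?_⟩
    choose b hb using fun i => hx.right.surjective (φ (Pi.single i 1))
    dsimp only at ha hb
    have hφ : ∀ v, φ v = ∑ i, v i • φ (Pi.single i 1) := fun v => by
      conv_lhs => rw [pi_eq_sum_univ' v]
      simp only [map_sum, map_smul]
    have hφ' : φ = ∑ i, b i • ε i := by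
      refine LinearMap.ext fun v => ?_
      rw [hφ]
      simp only [LinearMap.sum_apply, LinearMap.smul_apply, hε]
      exact Finset.sum_congr rfl fun i _ => by rw [← hb, smul_comm]
    rw [bidualMap_apply, hφ, hφ', map_sum]
    refine Finset.sum_congr rfl fun i _ => ?_
    rw [map_smul, ← ha, ← hφ', ← hb, smul_comm]

/-- For a free cover with kernel `K`, `Ext^1(K^*, U) = 0` extends a functional on `L^*` to the dual
of the free module. There it is evaluation at some `p`, hence evaluation at `π p` on `L^*`. -/
theorem surjective_bidualMap [IsNoetherianRing A] {x : U} (hx : IsTwoSidedGenerator A B x) {m : ℕ}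
    (hm : HasInjectiveDimensionLT (ModuleCat.of B U) m) (L : Type u) [AddCommGroup L] [Module A L]
    [Module.Finite A L] (hL : HigherExtVanish A L U) :
    Function.Surjective (bidualMap A B U L) := by
  obtain ⟨k, π, hπ⟩ := Module.Finite.exists_fin' A L
  have h := IsShortExact.of_surjective hπ
  have h' := h.dual (B := B) (h.exists_extension (hL 0))
  have hK := higherExtVanish_dual hx hm _
    (h.higherExtVanish (fun _ => extVanishes_of_projective _ _ _) hL)
  intro Φ
  obtain ⟨Ψ, rfl⟩ := h'.exists_extension (hK 0) Φ
  obtain ⟨p, rfl⟩ := (hx.bijective_bidualMap_pi k).surjective Ψ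
  exact ⟨π p, rfl⟩

theorem injective_bidualMap_of_injective {x : U} (hx : IsTwoSidedGenerator A B x) {k : ℕ}
    {M : Type u} [AddCommGroup M] [Module A M] {ι : M →ₗ[A] (Fin k → A)}
    (hι : Function.Injective ι) : Function.Injective (bidualMap A B U M) := by
  rw [injective_iff_map_eq_zero]
  intro m hm
  apply (injective_iff_map_eq_zero ι).mp hι
  apply (injective_iff_map_eq_zero _).mp (hx.bijective_bidualMap_pi k).injective
  ext φ
  exact LinearMap.congr_fun hm (φ ∘ₗ ι)

section Cokernel

variable {L Y : Type u} [AddCommGroup L] [Module A L] [AddCommGroup Y] [Module A Y] {k : ℕ}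
  {ι : L →ₗ[A] (Fin k → A)} {π : (Fin k → A) →ₗ[A] Y}

/-- Pulled back to `L^*`, the map `f` is evaluation at some `l`. It kills restrictions of
functionals on the free module, so `ι l = 0` by reflexivity and `l = 0`. -/
theorem IsShortExact.eq_zero_of_cokernel_dual (h : IsShortExact ι π) {x : U}
    (hx : IsTwoSidedGenerator A B x) (hL : Function.Surjective (bidualMap A B U L))
    (f : ((L →ₗ[A] U) ⧸ LinearMap.range (LinearMap.lcomp B U ι)) →ₗ[B] U) : f = 0 := by
  obtain ⟨l, hl⟩ := hL (f ∘ₗ Submodule.mkQ _)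
  have : ι l = 0 := by
    apply (injective_iff_map_eq_zero _).mp (hx.bijective_bidualMap_pi k).injective
    ext ψ
    have := LinearMap.congr_fun hl (LinearMap.lcomp B U ι ψ)
    simp only [bidualMap_apply, LinearMap.comp_apply] at this ⊢
    rw [show ψ (ι l) = _ from this, Submodule.mkQ_apply,
      (Submodule.Quotient.mk_eq_zero _).mpr (LinearMap.mem_range_self _ ψ)]
    simp
  rw [(injective_iff_map_eq_zero ι).mp h.inj l this, map_zero] at hl
  ext φ
  exact (LinearMap.congr_fun hl φ).symm

/-- Since `Ext^1(L^*, U) = 0`, it suffices to extend functionals from the image of the free dual to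
`L^*`. Such a functional is given by evaluation at some `p` killed by all of `Y^*`; so `p` comes
from `L`, and evaluation there is the extension. -/
theorem IsShortExact.extVanishes_cokernel_dual (h : IsShortExact ι π) {x : U}
    (hx : IsTwoSidedGenerator A B x) (hL : HigherExtVanish B (L →ₗ[A] U) U)
    (hY : Function.Injective (bidualMap A B U Y)) :
    ExtVanishes B ((L →ₗ[A] U) ⧸ LinearMap.range (LinearMap.lcomp B U ι)) U 1 := by
  have hs := IsShortExact.of_submodule (LinearMap.range (LinearMap.lcomp B U ι))
  refine hs.extVanishes_one (fun f => ?_) (hL 0)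
  obtain ⟨p, hp⟩ := (hx.bijective_bidualMap_pi k).surjective
    (f ∘ₗ (LinearMap.lcomp B U ι).rangeRestrict)
  have hπp : π p = 0 := by
    apply (injective_iff_map_eq_zero _).mp hY
    ext φ
    have := LinearMap.congr_fun hp (φ ∘ₗ π)
    have h0 : (LinearMap.lcomp B U ι).rangeRestrict (φ ∘ₗ π) = 0 := by
      ext l
      simp [h.exact.apply_apply_eq_zero]
    simpa [h0] using this
  obtain ⟨l, rfl⟩ := (h.exact p).mp hπp
  refine ⟨bidualMap A B U L l, ?_⟩
  ext ⟨_, ψ, rfl⟩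
  exact LinearMap.congr_fun hp ψ

end Cokernel

/-- The cokernel of a map to a finitely generated free module is the cokernel of its bidual if
the source maps onto its bidual. -/
noncomputable def IsTwoSidedGenerator.cokernelEquiv {x : U} (hx : IsTwoSidedGenerator A B x)
    {L : Type u} [AddCommGroup L] [Module A L] (hL : Function.Surjective (bidualMap A B U L))
    {l : ℕ} (d : L →ₗ[A] (Fin l → A)) :
    ((Fin l → A) ⧸ LinearMap.range d) ≃ₗ[A]
      ((((Fin l → A) →ₗ[A] U) →ₗ[B] U) ⧸
        LinearMap.range (LinearMap.lcomp A U (LinearMap.lcomp B U d))) :=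
  Submodule.Quotient.equiv _ _ (LinearEquiv.ofBijective _ (hx.bijective_bidualMap_pi l)) <| by
    ext Φ
    constructor
    · rintro ⟨_, ⟨v, rfl⟩, rfl⟩
      exact ⟨bidualMap A B U _ v, rfl⟩
    · rintro ⟨Ψ, rfl⟩
      obtain ⟨v, rfl⟩ := hL Ψ
      exact ⟨d v, ⟨v, rfl⟩, rfl⟩

end Duality

theorem ExtVanishes.of_linearEquiv {A M M' U : Type u} [Ring A] [AddCommGroup M] [Module A M]
    [AddCommGroup M'] [Module A M'] [AddCommGroup U] [Module A U] {i : ℕ} (e : M ≃ₗ[A] M')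
    (h : ExtVanishes A M U i) : ExtVanishes A M' U i := by
  refine subsingleton_of_forall_eq 0 fun x => ?_
  have h1 : (Ext.mk₀ (ModuleCat.ofHom e.toLinearMap)).comp x (zero_add i) = 0 := h.elim _ _
  rw [← Ext.mk₀_id_comp x, ← show ModuleCat.ofHom e.symm.toLinearMap ≫
    ModuleCat.ofHom e.toLinearMap = 𝟙 (ModuleCat.of A M') by ext y; simp, ← Ext.mk₀_comp_mk₀,
    Ext.comp_assoc_of_second_deg_zero, h1, Ext.comp_zero]

/-! ### Intrinsic description of the classes of `Ext^1` and `Ext^2` modules -/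

section SelfInjective

variable {R : Type u} [Ring R]

theorem isTwoSidedGenerator_one (R : Type u) [Ring R] :
    IsTwoSidedGenerator R Rᵐᵒᵖ (1 : R) :=
  ⟨by simpa [Function.id_def] using Function.bijective_id (α := R),
    by simpa using MulOpposite.unop_bijective⟩

/-- A presentation `0 → K → R^k → N → 0` of a finitely generated right module identifies
`Ext^1(N, R)` with the cokernel of the dual of `K → R^k`. -/
theorem exists_rightExtOneEquiv [IsNoetherianRing Rᵐᵒᵖ] (N : Type u) [AddCommGroup N]
    [Module Rᵐᵒᵖ N] [Module.Finite Rᵐᵒᵖ N] :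
    ∃ (k : ℕ) (K : Submodule Rᵐᵒᵖ (Fin k → Rᵐᵒᵖ)) (π : (Fin k → Rᵐᵒᵖ) →ₗ[Rᵐᵒᵖ] N),
      Module.Finite Rᵐᵒᵖ K ∧ IsShortExact K.subtype π ∧
      Nonempty (((K →ₗ[Rᵐᵒᵖ] R) ⧸ LinearMap.range (LinearMap.lcomp R R K.subtype)) ≃ₗ[R]
        RightExt R (ModuleCat.of Rᵐᵒᵖ N) 1) := by
  obtain ⟨k, π, hπ⟩ := Module.Finite.exists_fin' Rᵐᵒᵖ N
  have h := IsShortExact.of_surjective hπ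
  exact ⟨k, _, π, inferInstance, h, ⟨h.rightExtOneEquiv (extVanishes_of_projective _ _ _)⟩⟩

/-- Degree shifting along a free cover of a finitely generated right module. -/
theorem exists_rightExtTwoEquiv [IsNoetherianRing Rᵐᵒᵖ] (N : Type u) [AddCommGroup N]
    [Module Rᵐᵒᵖ N] [Module.Finite Rᵐᵒᵖ N] :
    ∃ (k : ℕ) (K : Submodule Rᵐᵒᵖ (Fin k → Rᵐᵒᵖ)) (π : (Fin k → Rᵐᵒᵖ) →ₗ[Rᵐᵒᵖ] N),
      Module.Finite Rᵐᵒᵖ K ∧ IsShortExact K.subtype π ∧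
      Nonempty (RightExt R (ModuleCat.of Rᵐᵒᵖ K) 1 ≃ₗ[R]
        RightExt R (ModuleCat.of Rᵐᵒᵖ N) 2) := by
  obtain ⟨k, π, hπ⟩ := Module.Finite.exists_fin' Rᵐᵒᵖ N
  have h := IsShortExact.of_surjective hπ
  exact ⟨k, _, π, inferInstance, h, ⟨h.rightExtTwoEquiv (extVanishes_of_projective _ _ _)
    (extVanishes_of_projective _ _ _)⟩⟩

theorem finite_rightExt_one [IsNoetherianRing R] [IsNoetherianRing Rᵐᵒᵖ] (N : Type u)
    [AddCommGroup N] [Module Rᵐᵒᵖ N] [Module.Finite Rᵐᵒᵖ N] :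
    Module.Finite R (RightExt R (ModuleCat.of Rᵐᵒᵖ N) 1) := by
  obtain ⟨k, K, π, hK, h, ⟨e⟩⟩ := exists_rightExtOneEquiv (R := R) N
  have := finite_dual (isTwoSidedGenerator_one R).swap K
  exact Module.Finite.equiv e

theorem finite_rightExt_two [IsNoetherianRing R] [IsNoetherianRing Rᵐᵒᵖ] (N : Type u)
    [AddCommGroup N] [Module Rᵐᵒᵖ N] [Module.Finite Rᵐᵒᵖ N] :
    Module.Finite R (RightExt R (ModuleCat.of Rᵐᵒᵖ N) 2) := by
  obtain ⟨k, K, π, hK, h, ⟨e⟩⟩ := exists_rightExtTwoEquiv (R := R) N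
  have := finite_rightExt_one (R := R) K
  exact Module.Finite.equiv e

theorem rightExt_one_hom_eq_zero [IsNoetherianRing Rᵐᵒᵖ]
    (hl : HasInjectiveDimensionLT (ModuleCat.of R R) 2)
    (hr : HasInjectiveDimensionLT (ModuleCat.of Rᵐᵒᵖ R) 2) (N : Type u)
    [AddCommGroup N] [Module Rᵐᵒᵖ N] [Module.Finite Rᵐᵒᵖ N]
    (f : RightExt R (ModuleCat.of Rᵐᵒᵖ N) 1 →ₗ[R] R) : f = 0 := by
  obtain ⟨k, K, π, hK, h, ⟨e⟩⟩ := exists_rightExtOneEquiv (R := R) N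
  have hKv : HigherExtVanish Rᵐᵒᵖ K R := fun i =>
    h.extVanishes_left (extVanishes_of_projective _ _ _) (hr.subsingleton _ _ _ (by omega) _)
  have hx := (isTwoSidedGenerator_one R).swap
  have := h.eq_zero_of_cokernel_dual hx (surjective_bidualMap hx hl _ hKv) (f ∘ₗ e.toLinearMap)
  ext y
  obtain ⟨y, rfl⟩ := e.surjective y
  exact LinearMap.congr_fun this y

theorem rightExt_two_hom_eq_zero_and_extVanishes [IsNoetherianRing Rᵐᵒᵖ]
    (hl : HasInjectiveDimensionLT (ModuleCat.of R R) 3)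
    (hr : HasInjectiveDimensionLT (ModuleCat.of Rᵐᵒᵖ R) 3) (N : Type u)
    [AddCommGroup N] [Module Rᵐᵒᵖ N] [Module.Finite Rᵐᵒᵖ N] :
    (∀ f : RightExt R (ModuleCat.of Rᵐᵒᵖ N) 2 →ₗ[R] R, f = 0) ∧
      ExtVanishes R (RightExt R (ModuleCat.of Rᵐᵒᵖ N) 2) R 1 := by
  obtain ⟨k, K, π, hK, h, ⟨e⟩⟩ := exists_rightExtTwoEquiv (R := R) N
  obtain ⟨l, L, ρ, hL, h', ⟨e'⟩⟩ := exists_rightExtOneEquiv (R := R) K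
  -- `L` is a second syzygy of `N`, so its Ext in degree `i + 1` is controlled by that of `N` in
  -- degree `i + 3`.
  have hLv : HigherExtVanish Rᵐᵒᵖ L R := fun i =>
    h'.extVanishes_left (extVanishes_of_projective _ _ _)
      (h.extVanishes_left (extVanishes_of_projective _ _ _)
        (hr.subsingleton _ _ _ (by omega) _))
  have hx := (isTwoSidedGenerator_one R).swap
  constructor
  · intro f
    have := h'.eq_zero_of_cokernel_dual hx (surjective_bidualMap hx hl _ hLv)
      (f ∘ₗ (e'.trans e).toLinearMap)
    ext y
    obtain ⟨y, rfl⟩ := (e'.trans e).surjective y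
    exact LinearMap.congr_fun this y
  · exact ExtVanishes.of_linearEquiv (e'.trans e)
      (h'.extVanishes_cokernel_dual hx (higherExtVanish_dual hx hl _ hLv)
        (injective_bidualMap_of_injective hx h.inj))

theorem extClass_one_iff [IsNoetherianRing R] [IsNoetherianRing Rᵐᵒᵖ]
    (hl : HasInjectiveDimensionLT (ModuleCat.of R R) 2)
    (hr : HasInjectiveDimensionLT (ModuleCat.of Rᵐᵒᵖ R) 2) (M : ModuleCat.{u} R) :
    extClass R 1 M ↔ Module.Finite R M ∧ ∀ f : M →ₗ[R] R, f = 0 := by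
  constructor
  · rintro ⟨hM, N, hN, ⟨e⟩⟩
    refine ⟨hM, fun f => ?_⟩
    have := rightExt_one_hom_eq_zero hl hr N (f ∘ₗ e.symm.toLinearMap)
    ext y
    simpa using LinearMap.congr_fun this (e y)
  · rintro ⟨hM, hf⟩
    refine ⟨hM, ?_⟩
    have hx := isTwoSidedGenerator_one R
    obtain ⟨k, π, hπ⟩ := Module.Finite.exists_fin' R M
    have h := IsShortExact.of_surjective hπ
    have hLv : HigherExtVanish R (LinearMap.ker π) R := fun i =>
      h.extVanishes_left (extVanishes_of_projective _ _ _) (hl.subsingleton _ _ _ (by omega) _)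
    have := finite_dual hx (LinearMap.ker π)
    have h' := IsShortExact.of_injective (h.injective_lcomp (B := Rᵐᵒᵖ) hf)
    -- The witness is the cokernel of `(R^k)^* → (ker π)^*`, injective because `Hom(M, R) = 0`.
    -- Dualizing once more gives back the cokernel of `ker π → R^k`, which is `M`.
    refine ⟨ModuleCat.of Rᵐᵒᵖ ((LinearMap.ker π →ₗ[R] R) ⧸ LinearMap.range
      (LinearMap.lcomp Rᵐᵒᵖ R (LinearMap.ker π).subtype)), inferInstance, ⟨?_⟩⟩
    exact (cokernelEquivOfExact h.exact h.surj).symm.trans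
      ((hx.cokernelEquiv (surjective_bidualMap hx hr _ hLv) _).trans
        (h'.rightExtOneEquiv (higherExtVanish_dual hx hr _ hLv 0)))

theorem extClass_two_iff [IsNoetherianRing R] [IsNoetherianRing Rᵐᵒᵖ]
    (hl : HasInjectiveDimensionLT (ModuleCat.of R R) 3)
    (hr : HasInjectiveDimensionLT (ModuleCat.of Rᵐᵒᵖ R) 3) (M : ModuleCat.{u} R) :
    extClass R 2 M ↔ Module.Finite R M ∧ (∀ f : M →ₗ[R] R, f = 0) ∧ ExtVanishes R M R 1 := by
  constructor
  · rintro ⟨hM, N, hN, ⟨e⟩⟩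
    obtain ⟨h0, h1⟩ := rightExt_two_hom_eq_zero_and_extVanishes hl hr N
    refine ⟨hM, fun f => ?_, h1.of_linearEquiv e.symm⟩
    ext y
    simpa using LinearMap.congr_fun (h0 (f ∘ₗ e.symm.toLinearMap)) (e y)
  · rintro ⟨hM, hf, hM1⟩
    refine ⟨hM, ?_⟩
    have hx := isTwoSidedGenerator_one R
    obtain ⟨k, π, hπ⟩ := Module.Finite.exists_fin' R M
    have h := IsShortExact.of_surjective hπ
    obtain ⟨l, ρ, hρ⟩ := Module.Finite.exists_fin' R (LinearMap.ker π)
    have h' := IsShortExact.of_surjective hρ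
    have hLv : HigherExtVanish R (LinearMap.ker ρ) R := fun i =>
      h'.extVanishes_left (extVanishes_of_projective _ _ _)
        (h.extVanishes_left (extVanishes_of_projective _ _ _)
          (hl.subsingleton _ _ _ (by omega) _))
    have hLd := higherExtVanish_dual hx hr _ hLv
    have := finite_dual hx (LinearMap.ker ρ)
    have := (hx.free_dual_pi l).1
    let d := (LinearMap.ker π).subtype ∘ₗ ρ
    have hd : Function.Exact d π := fun p => by
      simp only [d, LinearMap.comp_apply, Set.mem_range]
      exact ⟨fun hp => (hρ ⟨p, hp⟩).imp fun a ha => by rw [ha]; rfl,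
        fun ⟨a, ha⟩ => ha ▸ (ρ a).2⟩
    have s₁ := h'.dual_comp (B := Rᵐᵒᵖ) h hf hM1
    have s₂ := IsShortExact.of_submodule
      (LinearMap.range (LinearMap.lcomp Rᵐᵒᵖ R (LinearMap.ker ρ).subtype))
    -- The witness is now built from the second syzygy. `s₂` shifts its `Ext^2` to `Ext^1` of the
    -- image of `(R^l)^*`, and `s₁` presents that as the cokernel of the bidual of `d`, namely `M`.
    refine ⟨ModuleCat.of Rᵐᵒᵖ ((LinearMap.ker ρ →ₗ[R] R) ⧸ LinearMap.range
      (LinearMap.lcomp Rᵐᵒᵖ R (LinearMap.ker ρ).subtype)), inferInstance, ⟨?_⟩⟩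
    exact (cokernelEquivOfExact hd hπ).symm.trans
      ((hx.cokernelEquiv (hx.bijective_bidualMap_pi l).surjective d).trans
        ((s₁.rightExtOneEquiv (extVanishes_of_projective _ _ _)).trans
          (s₂.rightExtTwoEquiv (hLd 0) (hLd 1))))

end SelfInjective

/-! ### Character modules and flatness -/

section Character

variable {R : Type u} [Ring R]

/-- The character module of a left module is a right module. -/
noncomputable instance (M : Type v) [AddCommGroup M] [Module R M] :
    Module Rᵐᵒᵖ (CharacterModule M) where
  smul r c := AddMonoidHom.comp c (DistribSMul.toAddMonoidHom M r.unop)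
  one_smul c := by ext m; exact congrArg c (one_smul R m)
  mul_smul r s c := by ext m; exact congrArg c (mul_smul s.unop r.unop m)
  smul_zero r := rfl
  smul_add r c d := rfl
  add_smul r s c := by ext m; exact (congrArg c (add_smul _ _ m)).trans (map_add c _ _)
  zero_smul c := by ext m; exact (congrArg c (zero_smul R m)).trans (map_zero c)

/-- The homomorphism of character modules induced by a homomorphism of left modules. -/
noncomputable def characterMap {M M' : Type v} [AddCommGroup M] [Module R M] [AddCommGroup M']
    [Module R M'] (f : M →ₗ[R] M') : CharacterModule M' →ₗ[Rᵐᵒᵖ] CharacterModule M where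
  toFun c := AddMonoidHom.comp c f.toAddMonoidHom
  map_add' c d := rfl
  map_smul' r c := by ext m; exact congrArg c (f.map_smul r.unop m).symm

@[simp]
theorem characterMap_apply {M M' : Type v} [AddCommGroup M] [Module R M] [AddCommGroup M']
    [Module R M'] (f : M →ₗ[R] M') (c : CharacterModule M') (m : M) :
    characterMap f c m = c (f m) := rfl

theorem exists_character_extension {A B : Type*} [AddCommGroup A] [AddCommGroup B] (f : A →+ B)
    (hf : Function.Injective f) (c : CharacterModule A) :
    ∃ d : CharacterModule B, ∀ a, d (f a) = c a :=
  let ⟨d, hd⟩ := (Module.Baer.of_divisible (AddCircle (1 : ℚ))).extension_property_addMonoidHom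
    f hf c
  ⟨d, DFunLike.congr_fun hd⟩

theorem IsShortExact.character {L P Y : Type u} [AddCommGroup L] [Module R L] [AddCommGroup P]
    [Module R P] [AddCommGroup Y] [Module R Y] {ι : L →ₗ[R] P} {π : P →ₗ[R] Y}
    (h : IsShortExact ι π) : IsShortExact (characterMap π) (characterMap ι) where
  inj c d hcd := by
    ext y
    obtain ⟨p, rfl⟩ := h.surj y
    exact DFunLike.congr_fun hcd p
  exact c := by
    constructor
    · intro hc
      refine ⟨π.toAddMonoidHom.liftOfSurjective h.surj ⟨c, fun p hp => ?_⟩, ?_⟩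
      · obtain ⟨l, rfl⟩ := (h.exact p).mp hp
        exact DFunLike.congr_fun hc l
      · ext p
        exact AddMonoidHom.liftOfRightInverse_comp_apply _ _
          (Function.rightInverse_surjInv h.surj) _ p
    · rintro ⟨d, rfl⟩
      ext l
      rw [characterMap_apply, characterMap_apply, h.exact.apply_apply_eq_zero, map_zero]
      rfl
  surj c := by
    obtain ⟨d, hd⟩ := exists_character_extension ι.toAddMonoidHom h.inj c
    exact ⟨d, by ext l; exact hd l⟩

section Flat

variable {N N' : Type u} [AddCommGroup N] [Module Rᵐᵒᵖ N] [AddCommGroup N'] [Module Rᵐᵒᵖ N']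
  {M : Type u} [AddCommGroup M] [Module R M]

/-- A character of `N ⊗_R M` as a homomorphism from `N` to the character module of `M`. -/
noncomputable def curryCharacter (c : CharacterModule (BalancedTensor R N M)) :
    N →ₗ[Rᵐᵒᵖ] CharacterModule M where
  toFun n := (AddMonoidHom.comp c (QuotientAddGroup.mk' (balancedRel R N M))).comp
    (TensorProduct.mk ℤ N M n).toAddMonoidHom
  map_add' n n' := by
    ext m
    exact (congrArg (fun t => c (QuotientAddGroup.mk' (balancedRel R N M) t))
      (TensorProduct.add_tmul n n' m)).trans (by rw [map_add, map_add]; rfl)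
  map_smul' r n := by
    ext m
    refine congrArg c (QuotientAddGroup.eq_iff_sub_mem.mpr (AddSubgroup.subset_closure ?_))
    exact ⟨n, r.unop, m, rfl⟩

/-- A homomorphism from `N` to the character module of `M` as a character of `N ⊗_R M`. -/
noncomputable def uncurryCharacter (g : N →ₗ[Rᵐᵒᵖ] CharacterModule M) :
    CharacterModule (BalancedTensor R N M) :=
  QuotientAddGroup.lift (balancedRel R N M)
    (TensorProduct.liftAddHom (R := ℤ) (M := N) (N := M) (P := AddCircle (1 : ℚ))
      g.toAddMonoidHom fun r n m => by
        change g (r • n) m = g n (r • m)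
        rw [map_zsmul, map_zsmul]; rfl) <| by
    refine (AddSubgroup.closure_le _).2 ?_
    rintro _ ⟨n, r, m, rfl⟩
    change TensorProduct.liftAddHom _ _ _ = 0
    rw [map_sub, sub_eq_zero]
    change g (MulOpposite.op r • n) m = g n (r • m)
    rw [map_smul]
    rfl

theorem BalancedTensor.character_ext {c d : CharacterModule (BalancedTensor R N M)}
    (h : ∀ n m, c (QuotientAddGroup.mk' (balancedRel R N M) (n ⊗ₜ[ℤ] m)) =
      d (QuotientAddGroup.mk' (balancedRel R N M) (n ⊗ₜ[ℤ] m))) : c = d :=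
  QuotientAddGroup.addMonoidHom_ext _ <| by
    ext t
    induction t with
    | zero => exact (map_zero c).trans (map_zero d).symm
    | tmul n m => exact h n m
    | add s t hs ht => rw [map_add, map_add, hs, ht]

-- Lambek's criterion: characters of `N ⊗_R M` correspond to maps from `N` to the character module
-- of `M`, and `ℚ/ℤ` is an injective cogenerator of abelian groups.
variable (R M) in
theorem isFlat_iff_injective_character :
    IsFlat R M ↔ Module.Injective Rᵐᵒᵖ (CharacterModule M) := by
  constructor
  · intro h
    refine ⟨fun X Y _ _ _ _ f hf g => ?_⟩
    obtain ⟨c, hc⟩ := exists_character_extension _ (h X Y f hf) (uncurryCharacter g)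
    exact ⟨curryCharacter c, fun x => by
      ext m
      exact hc (QuotientAddGroup.mk' (balancedRel R X M) (x ⊗ₜ[ℤ] m))⟩
  · intro h X Y _ _ _ _ f hf
    rw [injective_iff_map_eq_zero]
    intro t ht
    by_contra h0
    obtain ⟨c, hc⟩ := CharacterModule.exists_character_apply_ne_zero_of_ne_zero h0
    obtain ⟨g, hg⟩ := h.out f hf (curryCharacter c)
    have : (AddMonoidHom.comp (uncurryCharacter g) (BalancedTensor.map f M) :
        CharacterModule (BalancedTensor R X M)) = c :=
      BalancedTensor.character_ext fun n m => DFunLike.congr_fun (hg n) m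
    apply hc
    rw [← this]
    exact (congrArg (uncurryCharacter g) ht).trans (map_zero _)

variable (R M) in
theorem isFlat_of_free [Module.Free R M] : IsFlat R M := by
  rw [isFlat_iff_injective_character]
  refine ⟨fun X Y _ _ _ _ f hf g => ?_⟩
  let b := Module.Free.chooseBasis R M
  choose d hd using fun i => exists_character_extension f.toAddMonoidHom hf
    ((AddMonoidHom.eval (b i)).comp g.toAddMonoidHom)
  -- A map to the character module of a free module is a family of characters, one per basis vector;
  -- each is extended separately and `H` reassembles them.
  let H : Y → (Module.Free.ChooseBasisIndex R M →₀ R) →+ AddCircle (1 : ℚ) := fun y =>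
    Finsupp.liftAddHom fun i => AddMonoidHom.comp (d i)
      (((smulAddHom Rᵐᵒᵖ Y).flip y).comp (MulOpposite.opAddEquiv (α := R)).toAddMonoidHom)
  have hH : ∀ y i r, H y (Finsupp.single i r) = d i (MulOpposite.op r • y) := fun y i r =>
    Finsupp.liftAddHom_apply_single _ i r
  let h : Y →ₗ[Rᵐᵒᵖ] CharacterModule M :=
    { toFun := fun y => (H y).comp b.repr.toLinearMap.toAddMonoidHom
      map_add' := fun y z => by
        have : H (y + z) = H y + H z := by
          ext i r
          change H (y + z) (Finsupp.single i r) =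
            H y (Finsupp.single i r) + H z (Finsupp.single i r)
          rw [hH, hH, hH, smul_add, map_add]
        rw [this]; rfl
      map_smul' := fun s y => by
        have : ∀ v, H (s • y) v = H y (s.unop • v) := fun v => by
          induction v using Finsupp.induction_linear with
          | zero => rw [smul_zero, map_zero, map_zero]
          | add v w hv hw => rw [smul_add, map_add, map_add, hv, hw]
          | single i r => rw [Finsupp.smul_single, hH, hH, smul_smul]; rfl
        ext m
        exact (this _).trans (congrArg (H y) (b.repr.map_smul _ _).symm) }
  refine ⟨h, fun x => ?_⟩
  have : ∀ v, H (f x) v = g x (b.repr.symm v) := fun v => by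
    induction v using Finsupp.induction_linear with
    | zero => rw [map_zero, map_zero, map_zero]
    | add v w hv hw => rw [map_add, map_add, map_add, hv, hw]
    | single i r =>
      rw [hH, ← map_smul, Module.Basis.repr_symm_single]
      refine (hd i _).trans ?_
      change g (MulOpposite.op r • x) (b i) = _
      rw [map_smul]
      rfl
  ext m
  exact (this _).trans (congrArg (g x) (b.repr.symm_apply_apply m))

end Flat

end Character

/-! ### Ext in the second variable and Baer's criterion -/

section Covariant

variable {A : Type u} [Ring A] {L P Y X : Type u} [AddCommGroup L] [Module A L]
  [AddCommGroup P] [Module A P] [AddCommGroup Y] [Module A Y] [AddCommGroup X] [Module A X]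
  {ι : L →ₗ[A] P} {π : P →ₗ[A] Y}

theorem IsShortExact.extVanishes_covariant_right (h : IsShortExact ι π) {i : ℕ}
    (hP : ExtVanishes A X P i) (hL : ExtVanishes A X L (i + 1)) : ExtVanishes A X Y i := by
  refine subsingleton_of_forall_eq 0 fun x => ?_
  obtain ⟨y, hy⟩ := Ext.covariant_sequence_exact₃ (ModuleCat.of A X) h.shortExact x rfl
    (hL.elim _ _)
  rw [← hy, show y = 0 from hP.elim _ _, Ext.zero_comp]

theorem IsShortExact.extVanishes_covariant_left (h : IsShortExact ι π) {i : ℕ}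
    (hY : ExtVanishes A X Y i) (hP : ExtVanishes A X P (i + 1)) : ExtVanishes A X L (i + 1) := by
  refine subsingleton_of_forall_eq 0 fun x => ?_
  obtain ⟨y, hy⟩ := Ext.covariant_sequence_exact₁ (ModuleCat.of A X) h.shortExact x
    (hP.elim _ _) rfl
  rw [← hy, show y = 0 from hY.elim _ _, Ext.zero_comp]

theorem injective_of_extVanishes (M : Type u) [AddCommGroup M] [Module A M]
    (h : ∀ I : Ideal A, ExtVanishes A (A ⧸ I) M 1) : Module.Injective A M :=
  Module.Baer.injective fun I g => by
    obtain ⟨g', hg⟩ := (IsShortExact.of_submodule I).exists_extension (h I) g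
    exact ⟨g', fun x hx => LinearMap.congr_fun hg ⟨x, hx⟩⟩

end Covariant

/-! ### The evaluation map `L ⊗ I → Hom(L^*, I)` for injective `I`, without tensor products -/

section Evaluation

variable {R : Type u} [Ring R] {I : Type u} [AddCommGroup I] [Module R I]
  {L P : Type u} [AddCommGroup L] [Module Rᵐᵒᵖ L] [AddCommGroup P] [Module Rᵐᵒᵖ P]

/-- The homomorphism `φ ↦ φ(l) x` from the dual of a right module `L` to a left module. -/
def evalSMul (l : L) (x : I) : (L →ₗ[Rᵐᵒᵖ] R) →ₗ[R] I :=
  LinearMap.toSpanSingleton R I x ∘ₗ bidualMap Rᵐᵒᵖ R R L l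

@[simp]
theorem evalSMul_apply (l : L) (x : I) (φ : L →ₗ[Rᵐᵒᵖ] R) : evalSMul l x φ = φ l • x := rfl

theorem sum_evalSMul_comp_lcomp (ι : L →ₗ[Rᵐᵒᵖ] P) {k : ℕ} (l : Fin k → L) (x : Fin k → I) :
    (∑ i, evalSMul (l i) (x i)) ∘ₗ LinearMap.lcomp R R ι = ∑ i, evalSMul (ι (l i)) (x i) := by
  ext φ
  simp

/-- The dual basis of `R^k`. -/
def dualBasis (R : Type u) [Ring R] (k : ℕ) (i : Fin k) : (Fin k → Rᵐᵒᵖ) →ₗ[Rᵐᵒᵖ] R where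
  toFun v := (v i).unop
  map_add' _ _ := rfl
  map_smul' _ _ := rfl

theorem dualBasis_sum {k : ℕ} (φ : (Fin k → Rᵐᵒᵖ) →ₗ[Rᵐᵒᵖ] R) :
    φ = ∑ i, φ (Pi.single i 1) • dualBasis R k i := by
  refine LinearMap.ext fun v => ?_
  conv_lhs => rw [pi_eq_sum_univ' v]
  simp only [map_sum, map_smul, LinearMap.sum_apply, LinearMap.smul_apply]
  rfl

theorem eq_sum_evalSMul {k : ℕ} (g : ((Fin k → Rᵐᵒᵖ) →ₗ[Rᵐᵒᵖ] R) →ₗ[R] I) :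
    g = ∑ i, evalSMul (Pi.single i 1) (g (dualBasis R k i)) := by
  refine LinearMap.ext fun φ => ?_
  conv_lhs => rw [dualBasis_sum φ]
  simp

theorem injective_lcomp_of_surjective {π : P →ₗ[Rᵐᵒᵖ] L} (hπ : Function.Surjective π) :
    Function.Injective (LinearMap.lcomp R R π) := fun f g hfg => by
  ext l
  obtain ⟨p, rfl⟩ := hπ l
  exact LinearMap.congr_fun hfg p

theorem exists_extension_of_injective [Module.Injective R I] {X Z : Type u} [AddCommGroup X]
    [Module R X] [AddCommGroup Z] [Module R Z] (f : X →ₗ[R] Z) (hf : Function.Injective f)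
    (g : X →ₗ[R] I) : ∃ h : Z →ₗ[R] I, h ∘ₗ f = g :=
  let ⟨h, hh⟩ := Module.Injective.out f hf g
  ⟨h, LinearMap.ext hh⟩

/-- This is surjectivity of the evaluation map: `L^*` embeds in the dual of a free cover, `g`
extends there, and the free case is explicit. -/
theorem exists_eq_sum_evalSMul [Module.Injective R I] [Module.Finite Rᵐᵒᵖ L]
    (g : (L →ₗ[Rᵐᵒᵖ] R) →ₗ[R] I) :
    ∃ (k : ℕ) (l : Fin k → L) (x : Fin k → I), g = ∑ i, evalSMul (l i) (x i) := by
  obtain ⟨k, π, hπ⟩ := Module.Finite.exists_fin' Rᵐᵒᵖ L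
  obtain ⟨h, rfl⟩ := exists_extension_of_injective _ (injective_lcomp_of_surjective hπ) g
  refine ⟨k, fun i => π (Pi.single i 1), fun i => h (dualBasis R k i), ?_⟩
  conv_lhs => rw [eq_sum_evalSMul h]
  exact sum_evalSMul_comp_lcomp _ _ _

/-- A character of `Hom(L^*, I)` as a homomorphism from `L` to the character module of `I`. -/
noncomputable def homOfCharacter (θ : CharacterModule ((L →ₗ[Rᵐᵒᵖ] R) →ₗ[R] I)) :
    L →ₗ[Rᵐᵒᵖ] CharacterModule I where
  toFun l := AddMonoidHom.mk' (fun x => θ (evalSMul l x)) fun x y => by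
    rw [← map_add]; congr 1; ext φ; simp
  map_add' l l' := by
    ext x
    refine Eq.trans ?_ (map_add θ _ _)
    refine congrArg θ ?_
    ext φ
    simp [add_smul]
  map_smul' r l := by
    ext x
    refine congrArg θ ?_
    ext φ
    simp [mul_smul]

/-- Dually, this is injectivity of the evaluation map: every character of `L ⊗ I`, seen as a map
`h`, comes from one of `Hom(L^*, I)`. -/
theorem homOfCharacter_surjective [IsNoetherianRing Rᵐᵒᵖ] [Module.Injective R I]
    [Module.Finite Rᵐᵒᵖ L] (h : L →ₗ[Rᵐᵒᵖ] CharacterModule I) : ∃ θ, homOfCharacter θ = h := by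
  obtain ⟨k, π, hπ⟩ := Module.Finite.exists_fin' Rᵐᵒᵖ L
  obtain ⟨m, ρ, hρ⟩ := Module.Finite.exists_fin' Rᵐᵒᵖ (LinearMap.ker π)
  let d := (LinearMap.ker π).subtype ∘ₗ ρ
  have hs := IsShortExact.of_surjective hπ
  let θ₀ : (((Fin k → Rᵐᵒᵖ) →ₗ[Rᵐᵒᵖ] R) →ₗ[R] I) →+ AddCircle (1 : ℚ) :=
    ∑ i, AddMonoidHom.comp (h (π (Pi.single i 1)))
      (LinearMap.applyₗ' ℤ (dualBasis R k i)).toAddMonoidHom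
  have hθ₀ : ∀ v x, θ₀ (evalSMul v x) = h (π v) x := fun v x => by
    conv_rhs => rw [pi_eq_sum_univ' v]
    simp only [map_sum, map_smul]
    exact (AddMonoidHom.finsetSum_apply _ _ _).trans (AddMonoidHom.finsetSum_apply
      (fun i => v i • h (π (Pi.single i 1)) : Fin k → I →+ AddCircle (1 : ℚ)) _ x).symm
  -- This lets `θ₀` descend to `Hom(L^*, I)`. A `G` vanishing on `L^*` factors through a submodule
  -- of `(R^m)^*`; extended to `(R^m)^*` it becomes a sum of evaluations at the relations `d e_j`,
  -- which `π` kills.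
  have key : ∀ G, G ∘ₗ LinearMap.lcomp R R π = 0 → θ₀ G = 0 := by
    intro G hG
    have hker : LinearMap.ker (LinearMap.lcomp R R d) ≤ LinearMap.ker G := by
      intro φ hφ
      obtain ⟨g, rfl⟩ := hs.exists_factor φ (by
        ext p
        obtain ⟨a, rfl⟩ := hρ p
        exact LinearMap.congr_fun hφ a)
      exact LinearMap.congr_fun hG g
    obtain ⟨G', hG'⟩ := exists_extension_of_injective
      ((LinearMap.ker (LinearMap.lcomp R R d)).liftQ (LinearMap.lcomp R R d) le_rfl)
      (LinearMap.ker_eq_bot.mp (Submodule.ker_liftQ_eq_bot _ _ _ le_rfl))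
      ((LinearMap.ker (LinearMap.lcomp R R d)).liftQ G hker)
    have hG : G = G' ∘ₗ LinearMap.lcomp R R d := by
      ext φ
      exact (LinearMap.congr_fun hG' (Submodule.Quotient.mk φ)).symm
    rw [hG, eq_sum_evalSMul G', sum_evalSMul_comp_lcomp, map_sum]
    refine Finset.sum_eq_zero fun j _ => ?_
    rw [hθ₀, show π (d (Pi.single j 1)) = 0 from (ρ _).2, map_zero]
    rfl
  let res : (((Fin k → Rᵐᵒᵖ) →ₗ[Rᵐᵒᵖ] R) →ₗ[R] I) →+ ((L →ₗ[Rᵐᵒᵖ] R) →ₗ[R] I) :=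
    (LinearMap.lcomp ℤ I (LinearMap.lcomp R R π)).toAddMonoidHom
  have hres : Function.Surjective res :=
    exists_extension_of_injective _ (injective_lcomp_of_surjective hπ)
  refine ⟨res.liftOfSurjective hres ⟨θ₀, key⟩, ?_⟩
  ext l x
  obtain ⟨v, rfl⟩ := hπ l
  refine Eq.trans ?_ (hθ₀ v x)
  exact AddMonoidHom.liftOfRightInverse_comp_apply _ _ (Function.rightInverse_surjInv hres) _
    (evalSMul v x)

/-- Both conditions express injectivity of `L ⊗ I → P ⊗ I`: the first through characters, the second
through `Hom(L^*, I) → Hom(P^*, I)`. -/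
theorem exists_extension_character_iff [IsNoetherianRing Rᵐᵒᵖ] [Module.Injective R I]
    [Module.Finite Rᵐᵒᵖ L] [Module.Finite Rᵐᵒᵖ P] (ι : L →ₗ[Rᵐᵒᵖ] P) :
    (∀ f : L →ₗ[Rᵐᵒᵖ] CharacterModule I, ∃ g : P →ₗ[Rᵐᵒᵖ] CharacterModule I, g ∘ₗ ι = f) ↔
      ∀ g : ((L →ₗ[Rᵐᵒᵖ] R) ⧸ LinearMap.range (LinearMap.lcomp R R ι)) →ₗ[R] I, g = 0 := by
  constructor
  · intro hf g
    suffices g ∘ₗ Submodule.mkQ _ = 0 from by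
      ext φ
      exact LinearMap.congr_fun this φ
    by_contra hg
    obtain ⟨θ, hθ⟩ := CharacterModule.exists_character_apply_ne_zero_of_ne_zero hg
    obtain ⟨f, hf⟩ := hf (homOfCharacter θ)
    obtain ⟨θ', rfl⟩ := homOfCharacter_surjective f
    obtain ⟨k, l, x, hk⟩ := exists_eq_sum_evalSMul (g ∘ₗ Submodule.mkQ _)
    apply hθ
    have h0 : ∑ i, evalSMul (R := R) (ι (l i)) (x i) = 0 := by
      rw [← show (g ∘ₗ Submodule.mkQ _) ∘ₗ LinearMap.lcomp R R ι = 0 from ?_, hk,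
        sum_evalSMul_comp_lcomp]
      ext ψ
      exact (congrArg g ((Submodule.Quotient.mk_eq_zero _).mpr
        (LinearMap.mem_range_self _ ψ))).trans (map_zero g)
    rw [hk, map_sum, ← map_zero θ', ← h0, map_sum]
    exact Finset.sum_congr rfl fun i _ =>
      (DFunLike.congr_fun (LinearMap.congr_fun hf (l i)) (x i)).symm
  · intro hg f
    obtain ⟨θ, rfl⟩ := homOfCharacter_surjective f
    obtain ⟨θ', hθ'⟩ := exists_character_extension
      (LinearMap.lcomp ℤ I (LinearMap.lcomp R R ι)).toAddMonoidHom
      ((injective_iff_map_eq_zero _).mpr fun g hg' => by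
        have := hg ((LinearMap.range (LinearMap.lcomp R R ι)).liftQ g
          (LinearMap.range_le_ker_iff.mpr hg'))
        ext φ
        exact LinearMap.congr_fun this (Submodule.Quotient.mk φ)) θ
    exact ⟨homOfCharacter θ', by ext l x; exact hθ' (evalSMul l x)⟩

end Evaluation

/-! ### Flat dimension of injective modules in terms of Ext -/

section Criteria

variable {R : Type u} [Ring R]

theorem forall_hom_eq_zero_congr {M M' I : Type u} [AddCommGroup M] [Module R M] [AddCommGroup M']
    [Module R M'] [AddCommGroup I] [Module R I] (e : M ≃ₗ[R] M') :
    (∀ g : M →ₗ[R] I, g = 0) ↔ ∀ g : M' →ₗ[R] I, g = 0 := by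
  constructor
  · intro h g
    ext y
    simpa using LinearMap.congr_fun (h (g ∘ₗ e.toLinearMap)) (e.symm y)
  · intro h g
    ext y
    simpa using LinearMap.congr_fun (h (g ∘ₗ e.symm.toLinearMap)) (e y)

section

variable [IsNoetherianRing Rᵐᵒᵖ] (I : Type u) [AddCommGroup I] [Module R I] [Module.Injective R I]
  (N : Type u) [AddCommGroup N] [Module Rᵐᵒᵖ N] [Module.Finite Rᵐᵒᵖ N]

theorem extVanishes_one_character_iff : ExtVanishes Rᵐᵒᵖ N (CharacterModule I) 1 ↔
    ∀ g : RightExt R (ModuleCat.of Rᵐᵒᵖ N) 1 →ₗ[R] I, g = 0 := by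
  obtain ⟨k, K, π, hK, h, ⟨e⟩⟩ := exists_rightExtOneEquiv (R := R) N
  rw [← forall_hom_eq_zero_congr e, ← exists_extension_character_iff]
  exact ⟨fun hN => h.exists_extension hN,
    fun hN => h.extVanishes_one hN (extVanishes_of_projective _ _ _)⟩

theorem extVanishes_two_character_iff : ExtVanishes Rᵐᵒᵖ N (CharacterModule I) 2 ↔
    ∀ g : RightExt R (ModuleCat.of Rᵐᵒᵖ N) 2 →ₗ[R] I, g = 0 := by
  obtain ⟨k, K, π, hK, h, ⟨e⟩⟩ := exists_rightExtTwoEquiv (R := R) N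
  rw [← forall_hom_eq_zero_congr e, ← extVanishes_one_character_iff]
  exact ⟨fun hN => h.extVanishes_left (extVanishes_of_projective _ _ _) hN,
    fun hN => h.extVanishes_right hN (extVanishes_of_projective _ _ _)⟩

end

theorem isFlat_iff_hom_rightExt_one [IsNoetherianRing Rᵐᵒᵖ] (I : Type u) [AddCommGroup I]
    [Module R I] [Module.Injective R I] : IsFlat R I ↔
      ∀ (N : Type u) [AddCommGroup N] [Module Rᵐᵒᵖ N] [Module.Finite Rᵐᵒᵖ N]
        (g : RightExt R (ModuleCat.of Rᵐᵒᵖ N) 1 →ₗ[R] I), g = 0 := by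
  rw [isFlat_iff_injective_character]
  constructor
  · intro h N _ _ _
    exact (extVanishes_one_character_iff I N).mp (extVanishes_of_injective _ _ _)
  · intro h
    exact injective_of_extVanishes _ fun 𝔞 => (extVanishes_one_character_iff I _).mpr (h _)

theorem hasFlatDimensionLE_one_iff_hom_rightExt_two [IsNoetherianRing Rᵐᵒᵖ] (I : Type u)
    [AddCommGroup I] [Module R I] [Module.Injective R I] : HasFlatDimensionLE R 1 I ↔
      ∀ (N : Type u) [AddCommGroup N] [Module Rᵐᵒᵖ N] [Module.Finite Rᵐᵒᵖ N]
        (g : RightExt R (ModuleCat.of Rᵐᵒᵖ N) 2 →ₗ[R] I), g = 0 := by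
  constructor
  · rintro ⟨F, _, _, p, hF, hp, hK⟩ N _ _ _
    replace hK : IsFlat R (LinearMap.ker p) := hK
    rw [isFlat_iff_injective_character] at hF hK
    exact (extVanishes_two_character_iff I N).mp
      ((IsShortExact.of_surjective hp).character.extVanishes_covariant_left
        (extVanishes_of_injective _ _ _) (extVanishes_of_injective _ _ _))
  · intro h
    have hp : Function.Surjective (Finsupp.linearCombination R (id : I → I)) :=
      Finsupp.linearCombination_id_surjective R I
    have hF : IsFlat R (I →₀ R) := isFlat_of_free _ _
    refine ⟨I →₀ R, inferInstance, inferInstance, _, hF, hp, ?_⟩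
    change IsFlat R _
    rw [isFlat_iff_injective_character] at hF ⊢
    exact injective_of_extVanishes _ fun 𝔞 =>
      (IsShortExact.of_surjective hp).character.extVanishes_covariant_right
        (extVanishes_of_injective _ _ _) ((extVanishes_two_character_iff I _).mpr (h _))

end Criteria

/-! ### Essential extensions and minimal injective resolutions -/

section Essential

variable {R : Type u} [Ring R] {M E : Type u} [AddCommGroup M] [Module R M] [AddCommGroup E]
  [Module R E]

instance injective_prod (E E' : Type u) [AddCommGroup E] [Module R E] [AddCommGroup E']
    [Module R E'] [Module.Injective R E] [Module.Injective R E'] :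
    Module.Injective R (E × E') where
  out X Y _ _ _ _ f hf g := by
    obtain ⟨h, hh⟩ := Module.Injective.out f hf (LinearMap.fst R E E' ∘ₗ g)
    obtain ⟨h', hh'⟩ := Module.Injective.out f hf (LinearMap.snd R E E' ∘ₗ g)
    exact ⟨h.prod h', fun x => Prod.ext (hh x) (hh' x)⟩

theorem forall_hom_prod_eq_zero_iff {X E' : Type u} [AddCommGroup X] [Module R X]
    [AddCommGroup E'] [Module R E'] : (∀ f : X →ₗ[R] E × E', f = 0) ↔
      (∀ f : X →ₗ[R] E, f = 0) ∧ ∀ f : X →ₗ[R] E', f = 0 := by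
  constructor
  · intro h
    refine ⟨fun f => ?_, fun f => ?_⟩
    · ext x
      exact congrArg Prod.fst (LinearMap.congr_fun (h (f.prod 0)) x)
    · ext x
      exact congrArg Prod.snd (LinearMap.congr_fun (h (LinearMap.prod 0 f)) x)
  · rintro ⟨h, h'⟩ f
    refine LinearMap.ext fun x => Prod.ext ?_ ?_
    · exact LinearMap.congr_fun (h (LinearMap.fst R E E' ∘ₗ f)) x
    · exact LinearMap.congr_fun (h' (LinearMap.snd R E E' ∘ₗ f)) x

/-- Homomorphisms to an essential injective extension `E` of `M` are detected on submodules by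
homomorphisms to `M`. -/
theorem forall_hom_eq_zero_iff_of_isEssential [Module.Injective R E] {ε : M →ₗ[R] E}
    (hε : Function.Injective ε) (hess : IsEssential (LinearMap.range ε)) (X : Type u)
    [AddCommGroup X] [Module R X] :
    (∀ f : X →ₗ[R] E, f = 0) ↔ ∀ (X' : Submodule R X) (f : X' →ₗ[R] M), f = 0 := by
  constructor
  · intro h X' f
    obtain ⟨g, hg⟩ := exists_extension_of_injective X'.subtype Subtype.val_injective (ε ∘ₗ f)
    ext x
    apply hε
    have := LinearMap.congr_fun hg x
    rw [h g] at this
    simpa using this.symm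
  · intro h f
    by_contra hf
    apply hess (LinearMap.range f) (by rwa [Ne, LinearMap.range_eq_bot])
    let e := LinearEquiv.ofInjective ε hε
    let f' : (LinearMap.range ε).comap f →ₗ[R] LinearMap.range ε :=
      (f ∘ₗ Submodule.subtype _).codRestrict _ fun x => x.2
    have h0 := h _ (e.symm.toLinearMap ∘ₗ f')
    rw [eq_bot_iff]
    rintro _ ⟨hy, x, rfl⟩
    have h1 := LinearMap.congr_fun h0 ⟨x, hy⟩
    have h2 : f' ⟨x, hy⟩ = 0 := by simpa using h1
    exact congrArg Subtype.val h2

/-- An injective submodule is a direct summand, and the complement `ker r` meets it trivially. -/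
theorem eq_top_of_isEssential_of_injective (L : Submodule R E) [Module.Injective R L]
    (hL : IsEssential L) : L = ⊤ := by
  obtain ⟨r, hr⟩ := exists_extension_of_injective L.subtype Subtype.val_injective LinearMap.id
  have hr' : ∀ x : L, r x = x := LinearMap.congr_fun hr
  have hker : LinearMap.ker r = ⊥ := by
    by_contra h
    apply hL _ h
    rw [eq_bot_iff]
    rintro x ⟨hx, hx'⟩
    have : r x = 0 := hx'
    rw [hr' ⟨x, hx⟩] at this
    exact congrArg Subtype.val this
  rw [eq_top_iff]
  intro x _
  have : x = r x := LinearMap.ker_eq_bot.mp hker (hr' (r x)).symm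
  rw [this]
  exact (r x).2

theorem subsingleton_of_isEssential_bot (h : IsEssential (⊥ : Submodule R E)) :
    Subsingleton E := by
  by_contra hE
  rw [not_subsingleton_iff_nontrivial] at hE
  exact h ⊤ top_ne_bot (bot_inf_eq _)

theorem hasFlatDimensionLE_of_subsingleton (i : ℕ) (M : Type u) [AddCommGroup M] [Module R M]
    [Subsingleton M] : HasFlatDimensionLE R i M := by
  induction i generalizing M with
  | zero => exact isFlat_of_free R M
  | succ i ih =>
    exact ⟨M, _, _, LinearMap.id, isFlat_of_free R M, Function.surjective_id, ih _⟩

namespace MinimalInjectiveResolution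

variable (J : MinimalInjectiveResolution R R)

instance (i : ℕ) : Module.Injective R (J.I i) := J.injective i

theorem isShortExact_zero : IsShortExact J.ε (J.d 0).rangeRestrict :=
  ⟨J.ε_injective, fun x => by rw [← J.exact_zero x, Subtype.ext_iff]; rfl,
    LinearMap.surjective_rangeRestrict _⟩

theorem forall_hom_zero_eq_zero_iff (X : Type u) [AddCommGroup X] [Module R X] :
    (∀ f : X →ₗ[R] J.I 0, f = 0) ↔ ∀ (X' : Submodule R X) (f : X' →ₗ[R] R), f = 0 :=
  forall_hom_eq_zero_iff_of_isEssential J.ε_injective J.essential_zero X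

/-- `I_1` is an essential extension of `I_0/R`. Once `Hom(X, I_0) = 0`, also `Hom(X', I_0) = 0` for
submodules, so `Ext^1(X', R)` vanishes iff `Hom(X', I_0/R)` does. -/
theorem forall_hom_prod_eq_zero_iff (X : Type u) [AddCommGroup X] [Module R X] :
    (∀ f : X →ₗ[R] J.I 0 × J.I 1, f = 0) ↔
      ∀ X' : Submodule R X, (∀ f : X' →ₗ[R] R, f = 0) ∧ ExtVanishes R X' R 1 := by
  rw [NoncommRing.forall_hom_prod_eq_zero_iff, forall_and, ← J.forall_hom_zero_eq_zero_iff]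
  refine and_congr_right fun h0 => ?_
  rw [forall_hom_eq_zero_iff_of_isEssential
    (Submodule.subtype_injective (LinearMap.range (J.d 0)))
    (by rw [Submodule.range_subtype]; exact J.essential_succ 0)]
  refine forall_congr' fun X' => ⟨fun h => ?_, fun h f => ?_⟩
  · exact J.isShortExact_zero.extVanishes_one_of_exists_lift (extVanishes_of_injective _ _ _)
      fun f => ⟨0, by rw [h f, LinearMap.comp_zero]⟩
  · obtain ⟨g, rfl⟩ := J.isShortExact_zero.exists_lift h f
    obtain ⟨g', rfl⟩ := exists_extension_of_injective X'.subtype Subtype.val_injective g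
    rw [h0 g', LinearMap.zero_comp, LinearMap.comp_zero]

/-- The cokernel `I_0/R` is injective, and it is essential in `I_1`. -/
theorem d_zero_surjective (hl : HasInjectiveDimensionLT (ModuleCat.of R R) 2) :
    Function.Surjective (J.d 0) := by
  have : Module.Injective R (LinearMap.range (J.d 0)) := injective_of_extVanishes _ fun 𝔞 =>
    J.isShortExact_zero.extVanishes_covariant_right (extVanishes_of_injective _ _ _)
      (hl.subsingleton _ _ _ le_rfl _)
  exact LinearMap.range_eq_top.mp
    (eq_top_of_isEssential_of_injective _ (J.essential_succ 0))

theorem subsingleton_add_two (hl : HasInjectiveDimensionLT (ModuleCat.of R R) 2) (i : ℕ) :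
    Subsingleton (J.I (i + 2)) := by
  suffices J.d (i + 1) = 0 from subsingleton_of_isEssential_bot
    (by rw [← LinearMap.range_eq_bot.mpr this]; exact J.essential_succ (i + 1))
  induction i with
  | zero =>
    ext x
    obtain ⟨y, rfl⟩ := J.d_zero_surjective hl x
    exact (J.exact_succ 0).apply_apply_eq_zero y
  | succ i ih =>
    have : Subsingleton (J.I (i + 2)) := subsingleton_of_isEssential_bot
      (by rw [← LinearMap.range_eq_bot.mpr ih]; exact J.essential_succ (i + 1))
    ext x
    rw [Subsingleton.elim x 0, map_zero, map_zero]

theorem auslanderCondition (hl : HasInjectiveDimensionLT (ModuleCat.of R R) 2)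
    (h : IsFlat R (J.I 0)) : AuslanderCondition R := by
  refine ⟨J, fun i => ?_⟩
  match i with
  | 0 => exact h
  | 1 =>
    let e : R ≃ₗ[R] LinearMap.ker (J.d 0) := (LinearEquiv.ofInjective J.ε J.ε_injective).trans
      (LinearEquiv.ofEq _ _ J.exact_zero.linearMap_ker_eq.symm)
    have := Module.Free.of_equiv e
    exact ⟨J.I 0, _, _, J.d 0, h, J.d_zero_surjective hl, isFlat_of_free R _⟩
  | i + 2 =>
    have := J.subsingleton_add_two hl i
    exact hasFlatDimensionLE_of_subsingleton _ _

theorem isSubmoduleClosed_extClass_one_iff [IsNoetherianRing R] [IsNoetherianRing Rᵐᵒᵖ]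
    (hl : HasInjectiveDimensionLT (ModuleCat.of R R) 2)
    (hr : HasInjectiveDimensionLT (ModuleCat.of Rᵐᵒᵖ R) 2) :
    IsSubmoduleClosed (extClass R 1) ↔ IsFlat R (J.I 0) := by
  rw [isFlat_iff_hom_rightExt_one]
  constructor
  · intro h N _ _ _
    refine (J.forall_hom_zero_eq_zero_iff _).mpr fun X' => ?_
    -- Submodule-closure speaks of nonzero submodules only.
    by_cases hX : X' = ⊥
    · subst hX
      exact fun f => Subsingleton.elim _ _
    · exact ((extClass_one_iff hl hr _).mp (h (ModuleCat.of R (RightExt R _ 1))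
        ⟨finite_rightExt_one N, _, ‹_›, ⟨LinearEquiv.refl _ _⟩⟩ X' hX)).2
  · rintro h M ⟨hM, N, hN, ⟨e⟩⟩ L -
    refine (extClass_one_iff hl hr _).mpr ⟨?_, ?_⟩
    · exact inferInstanceAs (Module.Finite R L)
    · exact (J.forall_hom_zero_eq_zero_iff M).mp
        ((forall_hom_eq_zero_congr e).mpr (h N)) L

theorem isSubmoduleClosed_extClass_two_iff [IsNoetherianRing R] [IsNoetherianRing Rᵐᵒᵖ]
    (hl : HasInjectiveDimensionLT (ModuleCat.of R R) 3)
    (hr : HasInjectiveDimensionLT (ModuleCat.of Rᵐᵒᵖ R) 3) :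
    IsSubmoduleClosed (extClass R 2) ↔ HasFlatDimensionLE R 1 (J.I 0 × J.I 1) := by
  rw [hasFlatDimensionLE_one_iff_hom_rightExt_two]
  constructor
  · intro h N _ _ _
    refine (J.forall_hom_prod_eq_zero_iff _).mpr fun X' => ?_
    by_cases hX : X' = ⊥
    · subst hX
      exact ⟨fun f => Subsingleton.elim _ _, extVanishes_of_projective _ _ _⟩
    · exact ((extClass_two_iff hl hr _).mp (h (ModuleCat.of R (RightExt R _ 2))
        ⟨finite_rightExt_two N, _, ‹_›, ⟨LinearEquiv.refl _ _⟩⟩ X' hX)).2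
  · rintro h M ⟨hM, N, hN, ⟨e⟩⟩ L -
    refine (extClass_two_iff hl hr _).mpr ⟨?_, ?_⟩
    · exact inferInstanceAs (Module.Finite R L)
    · exact (J.forall_hom_prod_eq_zero_iff M).mp
        ((forall_hom_eq_zero_congr e).mpr (h N)) L

end MinimalInjectiveResolution

end Essential

end NoncommRing

theorem corollary3p14 {R : Type u} [Ring R] (hl : IsNoetherianRing R)
    (hr : IsNoetherianRing Rᵐᵒᵖ) (J : NoncommRing.MinimalInjectiveResolution R R)
    (n : ℕ) (hn : n ≤ 2)
    (heq : NoncommRing.leftSelfInjDim R = NoncommRing.rightSelfInjDim R)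
    (hle : NoncommRing.leftSelfInjDim R ≤ (n : ℕ∞)) :
    (n = 1 →
      (NoncommRing.IsSubmoduleClosed (NoncommRing.extClass R 1) ↔
        NoncommRing.IsFlat R (J.I 0)) ∧
      (NoncommRing.IsFlat R (J.I 0) ↔ NoncommRing.IsAuslanderGorenstein R)) ∧
    (n = 2 →
      (NoncommRing.IsSubmoduleClosed (NoncommRing.extClass R 2) ↔
        NoncommRing.HasFlatDimensionLE R 1 (J.I 0 × J.I 1))) := by
  -- Dimension at most `n` unfolds to `HasInjectiveDimensionLT` with bound `n + 1`, hence the bounds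
  -- 2 and 3 above.
  have hL := (CategoryTheory.injectiveDimension_le_iff _ n).mp hle
  have hR := (CategoryTheory.injectiveDimension_le_iff _ n).mp (heq ▸ hle)
  have htop : NoncommRing.leftSelfInjDim R < ⊤ :=
    hle.trans_lt (WithBot.coe_lt_coe.mpr (ENat.natCast_lt_top n))
  constructor
  · rintro rfl
    refine ⟨J.isSubmoduleClosed_extClass_one_iff hL hR, fun h =>
      ⟨⟨hl, hr, htop, heq ▸ htop⟩, J.auslanderCondition hL h⟩, ?_⟩
    -- The Auslander condition may be witnessed by another resolution; flatness passes from `J'` to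
    -- `J` through submodule-closure, which mentions neither.
    rintro ⟨-, J', hJ'⟩
    exact (J.isSubmoduleClosed_extClass_one_iff hL hR).mp
      ((J'.isSubmoduleClosed_extClass_one_iff hL hR).mpr (hJ' 0))
  · rintro rfl
    exact J.isSubmoduleClosed_extClass_two_iff hL hR
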